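/- **Proposition 2.5.** Let $\alpha\in\mathbb R$, $\beta>0$ be such that $g:=\tfrac12+\tfrac{\alpha}{\beta}>0$. For $k\ge 1$, $\lambda\in\mathbb C$, $x\in\mathbb R^k$, $y\in\mathbb R^{k-1}$ put $$\Lambda_\lambda(x|y)=\exp\Bigl(i\lambda\bigl(\textstyle\sum_{j=1}^k x_j-\sum_{j=1}^{k-1} y_j\bigr)-\sum_{j=1}^{k-1}\bigl(e^{x_j-y_j}+e^{y_j-x_{j+1}}\bigr)\Bigr),$$ and, for $\lambda\in\mathbb R$, $$\mathbb L_\lambda(x|y)=\frac{(2\beta)^{i\lambda}}{\Gamma(g-i\lambda)}\int_{\mathbb R^k}dz\;(1+\beta e^{-z_1})^{-i\lambda-g}(1-\beta e^{-z_1})^{-i\lambda+g-1}\,\theta(z_1-\ln\beta)$$ $$\times\exp\Bigl(i\lambda\bigl(\textstyle\sum_{j=1}^k x_j+\sum_{j=1}^{k-1} y_j-2\sum_{j=1}^k z_j\bigr)-\sum_{j=1}^{k-1}\bigl(e^{z_j-x_j}+e^{z_j-y_j}+e^{x_j-z_{j+1}}+e^{y_j-z_{j+1}}\bigr)-e^{z_k-x_k}\Bigr),$$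 where $\theta$ is the Heaviside step function ($\theta(t)=1$ for $t\ge0$ and $\theta(t)=0$ for $t<0$). Define the wave functions of the $GL_n$ and $BC_n$ quantum Toda chains recursively, starting from $1$ for zero variables, by $$\Phi_{\lambda_1,\dots,\lambda_k}(x)=\int_{\mathbb R^{k-1}}\Lambda_{\lambda_k}(x|y)\,\Phi_{\lambda_1,\dots,\lambda_{k-1}}(y)\,dy\quad(\lambda_j\in\mathbb C),$$ $$\Psi_{\lambda_1,\dots,\lambda_k}(x)=\int_{\mathbb R^{k-1}}\mathbb L_{\lambda_k}(x|y)\,\Psi_{\lambda_1,\dots,\lambda_{k-1}}(y)\,dy\quad(\lambda_j\in\mathbb R);$$ in particular $\Phi_{\lambda_1}(x_1)=e^{i\lambda_1x_1}$ and $\Psi_{\lambda_1}(x_1)=\mathbb L_{\lambda_1}(x_1|\,\cdot\,)$ (no variables $y$). Let $n\ge1$, $\lambda=(\lambda_1,\dots,\lambda_n)\in\mathbb R^n$, and let $\rho=(\rho_1,\dots,\rho_n)\in\mathbb C^n$ satisfy $\operatorname{Im}\rho_1=\dots=\operatorname{Im}\rho_n<0$. Then the following integral converges absolutely, and $$\int_{\mathbb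 R^n}\Phi_{-\rho}(x)\,\Psi_\lambda(x)\,\exp(-\beta e^{-x_1})\,dx=\frac{(2\beta)^{-i(\rho_1+\dots+\rho_n)}\prod_{j,k=1}^n\Gamma(i\rho_j+i\lambda_k)\,\Gamma(i\rho_j-i\lambda_k)}{\prod_{1\le j<k\le n}\Gamma(i\rho_j+i\rho_k)\,\prod_{j=1}^n\Gamma(g+i\rho_j)}.$$ -/

import Mathlib

open MeasureTheory

noncomputable section

namespace Toda

/-- The Heaviside step function, equal to `1` on `[0, ∞)` and to `0` on `(-∞, 0)`. -/
def heaviside (t : ℝ) : ℝ := if 0 ≤ t then 1 else 0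

/-- The coupling `g = 1/2 + α/β` of the `BC` Toda chain with boundary parameters `α, β`. -/
def coupling (α β : ℝ) : ℝ := 1 / 2 + α / β

/-- The kernel `Λ_lam(x | y)` of the `GL` raising operator from `m` to `m + 1` variables. -/
def glKernel {m : ℕ} (lam : ℂ) (x : Fin (m + 1) → ℝ) (y : Fin m → ℝ) : ℂ :=
  Complex.exp
    (Complex.I * lam * (((∑ j, x j) - ∑ j, y j : ℝ) : ℂ)
      - ((∑ j : Fin m, (Real.exp (x j.castSucc - y j) + Real.exp (y j - x j.succ)) : ℝ) : ℂ))

/-- The `GL` raising operator `Λ_{m+1}(lam)`. -/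
def glRaise {m : ℕ} (lam : ℂ) (φ : (Fin m → ℝ) → ℂ) (x : Fin (m + 1) → ℝ) : ℂ :=
  ∫ y : Fin m → ℝ, glKernel lam x y * φ y

/-- The boundary factor
`(1 + β e^{-t})^{-i lam - g} (1 - β e^{-t})^{-i lam + g - 1} θ(t - ln β)`. -/
def bcBoundary (β g : ℝ) (lam : ℂ) (t : ℝ) : ℂ :=
  ((1 + β * Real.exp (-t) : ℝ) : ℂ) ^ (-(Complex.I * lam) - (g : ℂ))
    * ((1 - β * Real.exp (-t) : ℝ) : ℂ) ^ (-(Complex.I * lam) + (g : ℂ) - 1)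
    * ((heaviside (t - Real.log β) : ℝ) : ℂ)

/-- The kernel of the `BC` raising operator from `m` to `m + 1` variables. -/
def bcKernel {m : ℕ} (β g : ℝ) (lam : ℂ) (x : Fin (m + 1) → ℝ) (y : Fin m → ℝ) : ℂ :=
  ((2 * β : ℝ) : ℂ) ^ (Complex.I * lam) / Complex.Gamma ((g : ℂ) - Complex.I * lam)
    * ∫ z : Fin (m + 1) → ℝ,
        bcBoundary β g lam (z 0)
          * Complex.exp
            (Complex.I * lam * (((∑ j, x j) + (∑ j, y j) - 2 * ∑ j, z j : ℝ) : ℂ)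
              - ((∑ j : Fin m,
                    (Real.exp (z j.castSucc - x j.castSucc) + Real.exp (z j.castSucc - y j)
                      + Real.exp (x j.castSucc - z j.succ) + Real.exp (y j - z j.succ)) : ℝ) : ℂ)
              - ((Real.exp (z (Fin.last m) - x (Fin.last m)) : ℝ) : ℂ))

/-- The `BC` raising operator from `m` to `m + 1` variables. -/
def bcRaise {m : ℕ} (β g : ℝ) (lam : ℂ) (φ : (Fin m → ℝ) → ℂ) (x : Fin (m + 1) → ℝ) : ℂ :=
  ∫ y : Fin m → ℝ, bcKernel β g lam x y * φ y

/-- The `GL` Toda wave function `Φ_lam(x) = Λ_n(lam_n) ⋯ Λ_1(lam_1) · 1`. -/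
def glWave : (n : ℕ) → (Fin n → ℂ) → (Fin n → ℝ) → ℂ
  | 0, _ => fun _ => 1
  | m + 1, lam => glRaise (lam (Fin.last m)) (glWave m (fun j => lam j.castSucc))

/-- The `BC` Toda wave function `Ψ_lam(x)`, the product of the `BC` raising operators with
spectral parameters `lam_n, …, lam_1` applied to the constant function `1`. -/
def bcWave (β g : ℝ) : (n : ℕ) → (Fin n → ℂ) → (Fin n → ℝ) → ℂ
  | 0, _ => fun _ => 1
  | m + 1, lam => bcRaise β g (lam (Fin.last m)) (bcWave β g m (fun j => lam j.castSucc))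

end Toda

end

/-! Put σ_j = iρ_j, κ_k = iλ_k, a = 2β. In the boundary coordinate of the BC kernel the substitution
e^s = e^t + β merges the two boundary powers into the single power (1 - a e^{-s})^{g-κ-1}. Up to
normalizing constants and the gauge factor exp(-β e^{-x_1}), Ψ thereby becomes `psi` (`bcKernel_eq`,
`represents_psi`). The exponential in the integral is exactly this gauge factor, so what has to be
computed is the pairing of `phi` with `psi`.

The pairing is found by induction on n (`int_phi_psi_succ`). The tools are the Baxter operators,
which preserve the number of variables and are diagonal on the wave functions, with eigenvalues
∏Γ(σ_j - κ) for GL (`int_w_phi`) and ∏Γ(s - κ_k)Γ(s + κ_k) for BC (`int_baxter_psi`). The last BC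
raising kernel contains a GL Baxter kernel, which acts on `phi`. The remaining integral against the
last GL raising kernel loses one dimension by `int_w_w`, at the cost of a Beta integral, and
produces a second GL Baxter operator. After multiplication by ∏Γ(σ_j + σ_n), j < n, what is left is
a BC Baxter operator applied to `psi` in one variable less; this multiplier is the source of the
Gammas Γ(iρ_j + iρ_k) in the denominator.

Diagonality follows by moving a Baxter operator past one raising operator (`int_w_mul_w`,
`int_baxter_raiseKer`). With the outer variables fixed, each integral splits into one-variable
integrals of exp(cv - A e^{-v} - B e^v). Their symmetry c ↦ -c (`besselInt_inv`) costs a power of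
A/B, and these powers telescope along the chain. Only the boundary coordinate remains; it is
governed by a fractional integral (`gam_mul_int`) and by the symmetry `rl_reflKer_symm`.

Convergence comes with the identity. All computations take place in `DomC`, where a value carries an
upper bound and Fubini is unconditional. The bound component of the final identity is the same
identity for integrals of absolute values, so its finite right side forces absolute convergence.
`Represents` transfers the result to the nested Bochner integrals of the statement. -/

noncomputable section

/-! ### Dominated complex numbers and unconditional integration. -/

namespace Toda

open scoped ENNReal

/-- The pairs `(z, e)` with `‖z‖ₑ ≤ e`, and `z = 0` if `e = ∞`, as a submonoid. -/
def domSubmonoid : Submonoid (ℂ × ℝ≥0∞) where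
  carrier := {p | ‖p.1‖ₑ ≤ p.2 ∧ (p.2 = ∞ → p.1 = 0)}
  one_mem' := by simp
  mul_mem' := by
    rintro ⟨z, e⟩ ⟨w, f⟩ ⟨h1, h2⟩ ⟨h3, h4⟩
    simp only [Set.mem_ofPred_eq, Prod.mk_mul_mk] at *
    refine ⟨by rw [enorm_mul]; exact mul_le_mul' h1 h3, fun h => ?_⟩
    rcases ENNReal.mul_eq_top.1 h with h | h
    · simp [h4 h.2]
    · simp [h2 h.1]

/-- Dominated complex numbers: complex numbers together with an upper bound of the absolute value,
where the value is `0` as soon as the bound is infinite. Integrals of functions with values in this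
monoid obey the Fubini theorem without any integrability hypothesis. -/
def DomC : Type := ↥domSubmonoid

namespace DomC

instance : CommMonoid DomC := inferInstanceAs (CommMonoid ↥domSubmonoid)

instance : MeasurableSpace DomC := inferInstanceAs (MeasurableSpace ↥domSubmonoid)

/-- The complex value of a dominated complex number. -/
def val (d : DomC) : ℂ := d.1.1

/-- The bound of a dominated complex number. -/
def bd (d : DomC) : ℝ≥0∞ := d.1.2

theorem enorm_val_le (d : DomC) : ‖d.val‖ₑ ≤ d.bd := d.2.1

theorem val_eq_zero (d : DomC) (h : d.bd = ∞) : d.val = 0 := d.2.2 h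

theorem val_eq_zero_of_bd (d : DomC) (h : d.bd = 0) : d.val = 0 := by
  have := d.enorm_val_le
  rw [h] at this
  simpa using this

/-- An infinite bound forces the value 0, so values need comparison only where the bound is finite.
-/
theorem ext {d e : DomC} (h : d.bd = e.bd) (h' : d.bd ≠ ∞ → d.val = e.val) : d = e := by
  refine Subtype.ext (Prod.ext ?_ h)
  by_cases ht : d.bd = ∞
  · exact (d.val_eq_zero ht).trans (e.val_eq_zero (h ▸ ht)).symm
  · exact h' ht

@[simp] theorem val_mul (d e : DomC) : (d * e).val = d.val * e.val := rfl
@[simp] theorem bd_mul (d e : DomC) : (d * e).bd = d.bd * e.bd := rfl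
@[simp] theorem val_one : (1 : DomC).val = 1 := rfl
@[simp] theorem bd_one : (1 : DomC).bd = 1 := rfl

/-- `val` as a monoid homomorphism. -/
def valHom : DomC →* ℂ := ⟨⟨val, rfl⟩, fun _ _ => rfl⟩

/-- `bd` as a monoid homomorphism. -/
def bdHom : DomC →* ℝ≥0∞ := ⟨⟨bd, rfl⟩, fun _ _ => rfl⟩

theorem val_prod {ι : Type*} (s : Finset ι) (f : ι → DomC) :
    (∏ i ∈ s, f i).val = ∏ i ∈ s, (f i).val := map_prod valHom f s

theorem bd_prod {ι : Type*} (s : Finset ι) (f : ι → DomC) :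
    (∏ i ∈ s, f i).bd = ∏ i ∈ s, (f i).bd := map_prod bdHom f s

@[fun_prop] theorem measurable_val : Measurable val :=
  measurable_fst.comp measurable_subtype_coe

@[fun_prop] theorem measurable_bd : Measurable bd :=
  measurable_snd.comp measurable_subtype_coe

theorem measurable_of {A : Type*} [MeasurableSpace A] {f : A → DomC}
    (h : Measurable fun a => (f a).val) (h' : Measurable fun a => (f a).bd) : Measurable f :=
  Measurable.subtype_mk (p := (· ∈ domSubmonoid)) (f := fun a => ((f a).val, (f a).bd))
    (h := fun a => (f a).2) (h.prodMk h')

instance : MeasurableMul₂ DomC := ⟨measurable_of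
  (by simp only [val_mul]; fun_prop) (by simp only [bd_mul]; fun_prop)⟩

/-- A complex number, dominated by its own absolute value. -/
def of : ℂ →* DomC where
  toFun z := ⟨(z, ‖z‖ₑ), le_rfl, fun h => absurd h enorm_ne_top⟩
  map_one' := Subtype.ext (by
    show ((1 : ℂ), ‖(1 : ℂ)‖ₑ) = 1
    simp)
  map_mul' z w := Subtype.ext (by
    show (z * w, ‖z * w‖ₑ) = (z * w, ‖z‖ₑ * ‖w‖ₑ)
    rw [enorm_mul])

@[simp] theorem val_of (z : ℂ) : (of z).val = z := rfl
@[simp] theorem bd_of (z : ℂ) : (of z).bd = ‖z‖ₑ := rfl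

@[fun_prop] theorem measurable_of_coe : Measurable (of : ℂ → DomC) :=
  measurable_of (by simp only [val_of]; fun_prop) (by simp only [bd_of]; fun_prop)

@[fun_prop] theorem _root_.Measurable.domOf {A : Type*} [MeasurableSpace A] {f : A → ℂ}
    (h : Measurable f) : Measurable fun a => of (f a) := measurable_of_coe.comp h

theorem of_zero_mul (d : DomC) : of 0 * d = of 0 := by
  apply ext
  · simp
  · simp

variable {A B : Type*} [MeasurableSpace A] [MeasurableSpace B]

open Classical in
/-- The integral of a function with values in the dominated complex numbers. -/
def int (μ : Measure A) (F : A → DomC) : DomC :=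
  ⟨(if ∫⁻ a, (F a).bd ∂μ = ∞ then 0 else ∫ a, (F a).val ∂μ, ∫⁻ a, (F a).bd ∂μ), by
    constructor
    · dsimp only
      split_ifs
      · simp
      · exact (enorm_integral_le_lintegral_enorm _).trans
          (lintegral_mono fun a => (F a).enorm_val_le)
    · intro h
      dsimp only at h ⊢
      rw [if_pos h]⟩

theorem bd_int (μ : Measure A) (F : A → DomC) : (int μ F).bd = ∫⁻ a, (F a).bd ∂μ := rfl

theorem val_int {μ : Measure A} {F : A → DomC} (h : ∫⁻ a, (F a).bd ∂μ ≠ ∞) :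
    (int μ F).val = ∫ a, (F a).val ∂μ := if_neg h

theorem int_congr {μ : Measure A} {F G : A → DomC} (h : ∀ a, F a = G a) : int μ F = int μ G := by
  rw [funext h]

theorem int_congr_ae {μ : Measure A} {F G : A → DomC} (h : ∀ᵐ a ∂μ, F a = G a) :
    int μ F = int μ G := by
  have h1 : ∫⁻ a, (F a).bd ∂μ = ∫⁻ a, (G a).bd ∂μ :=
    lintegral_congr_ae (h.mono fun a ha => by simp only [ha])
  refine ext h1 fun ht => ?_
  rw [val_int ht, val_int (by rwa [← h1])]
  exact integral_congr_ae (h.mono fun a ha => by simp only [ha])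

theorem integrable_val {μ : Measure A} {F : A → DomC} (hF : Measurable F)
    (h : ∫⁻ a, (F a).bd ∂μ ≠ ∞) : Integrable (fun a => (F a).val) μ :=
  ⟨(measurable_val.comp hF).aestronglyMeasurable,
    (lintegral_mono fun a => (F a).enorm_val_le).trans_lt h.lt_top⟩

/-- The only delicate case is a divergent integral: if `c` has bound 0 then both sides have bound 0
· ∞ = 0 and value 0, otherwise both bounds are infinite. -/
theorem int_const_mul (μ : Measure A) (c : DomC) {F : A → DomC} (hF : Measurable F) :
    int μ (fun a => c * F a) = c * int μ F := by
  have h1 : ∫⁻ a, (c * F a).bd ∂μ = c.bd * ∫⁻ a, (F a).bd ∂μ := by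
    simp only [bd_mul]
    exact lintegral_const_mul _ (measurable_bd.comp hF)
  refine ext h1 fun ht => ?_
  have ht' : ∫⁻ a, (c * F a).bd ∂μ ≠ ∞ := ht
  rw [val_int ht]
  simp only [val_mul]
  rw [integral_const_mul]
  by_cases hi : ∫⁻ a, (F a).bd ∂μ = ∞
  · rw [h1, hi] at ht'
    have hc : c.bd = 0 := by
      by_contra hc
      exact ht' (ENNReal.mul_top hc)
    rw [c.val_eq_zero_of_bd hc]
    simp
  · rw [val_int hi]

theorem int_mul_const (μ : Measure A) (c : DomC) {F : A → DomC} (hF : Measurable F) :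
    int μ (fun a => F a * c) = int μ F * c := by
  simp only [mul_comm _ c, int_const_mul μ c hF]

@[fun_prop] theorem measurable_int {ν : Measure B} [SFinite ν] {F : A → B → DomC}
    (hF : Measurable fun p : A × B => F p.1 p.2) : Measurable fun a => int ν (F a) := by
  have h1 : Measurable fun a => ∫⁻ b, (F a b).bd ∂ν :=
    Measurable.lintegral_prod_right' (measurable_bd.comp hF)
  refine measurable_of ?_ h1
  refine Measurable.ite (measurableSet_eq_fun h1 measurable_const) measurable_const ?_
  exact (StronglyMeasurable.integral_prod_right'
    (measurable_val.comp hF).stronglyMeasurable).measurable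

/-- Tonelli identifies the bounds. If they are finite, Fubini applies, and the inner value is
replaced by 0 only on a null set; if they are infinite, both values are 0. -/
theorem int_prod {μ : Measure A} {ν : Measure B} [SFinite ν] [SFinite μ] {F : A × B → DomC}
    (hF : Measurable F) :
    int (μ.prod ν) F = int μ fun a => int ν fun b => F (a, b) := by
  have h1 : ∫⁻ p, (F p).bd ∂μ.prod ν = ∫⁻ a, ∫⁻ b, (F (a, b)).bd ∂ν ∂μ :=
    lintegral_prod _ (measurable_bd.comp hF).aemeasurable
  refine ext h1 fun ht => ?_
  have ht' : ∫⁻ p, (F p).bd ∂μ.prod ν ≠ ∞ := ht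
  have hm : Measurable fun a => ∫⁻ b, (F (a, b)).bd ∂ν :=
    Measurable.lintegral_prod_right' (measurable_bd.comp hF)
  rw [val_int ht', integral_prod _ (integrable_val hF ht'), val_int (by simpa only [bd_int, ← h1])]
  refine integral_congr_ae ?_
  rw [h1] at ht'
  filter_upwards [ae_lt_top hm ht'] with a ha
  rw [val_int ha.ne]

theorem int_map {μ : Measure A} {ν : Measure B} {e : A ≃ᵐ B} (he : MeasurePreserving e μ ν)
    (F : B → DomC) : int ν F = int μ fun a => F (e a) := by
  have h1 : ∫⁻ b, (F b).bd ∂ν = ∫⁻ a, (F (e a)).bd ∂μ := by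
    rw [← he.map_eq, lintegral_map_equiv]
  refine ext h1 fun ht => ?_
  rw [val_int ht, val_int (by rwa [← h1]), ← he.integral_comp' (g := fun b => (F b).val)]

theorem int_swap {μ : Measure A} {ν : Measure B} [SFinite μ] [SFinite ν] {F : A → B → DomC}
    (hF : Measurable fun p : A × B => F p.1 p.2) :
    (int μ fun a => int ν fun b => F a b) = int ν fun b => int μ fun a => F a b := by
  rw [← int_prod (F := fun p : A × B => F p.1 p.2) hF,
    int_map (e := MeasurableEquiv.prodComm) (Measure.measurePreserving_swap (μ := ν) (ν := μ))]
  exact int_prod (F := fun p : B × A => F p.2 p.1) (hF.comp measurable_swap)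

theorem int_unique [Unique A] (μ : Measure A) [IsProbabilityMeasure μ] (F : A → DomC) :
    int μ F = F default := by
  have h1 : ∫⁻ a, (F a).bd ∂μ = (F default).bd := by
    rw [lintegral_unique]; simp
  refine ext h1 fun ht => ?_
  rw [val_int ht, integral_unique]; simp

/-- This is what reduces the multiple integrals over interlacing variables to one-variable
integrals. -/
theorem int_fin_prod {n : ℕ} {f : Fin n → ℝ → DomC} (hf : ∀ j, Measurable (f j)) :
    int volume (fun x : Fin n → ℝ => ∏ j, f j (x j)) = ∏ j, int volume (f j) := by
  induction n with
  | zero =>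
    have : IsProbabilityMeasure (volume : Measure (Fin 0 → ℝ)) :=
      ⟨by rw [volume_pi, Measure.pi_univ]; simp⟩
    rw [int_unique]; simp
  | succ n ih =>
    have hp := (volume_preserving_piFinSuccAbove (fun _ : Fin (n + 1) => ℝ) 0).symm
    rw [int_map hp]
    have hm : Measurable fun p : ℝ × (Fin n → ℝ) =>
        f 0 p.1 * ∏ j : Fin n, f j.succ (p.2 j) := by
      refine Measurable.mul ((hf 0).comp measurable_fst) ?_
      exact Finset.measurable_fun_prod _ fun j _ =>
        (hf j.succ).comp ((measurable_pi_apply j).comp measurable_snd)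
    have : (fun p : ℝ × (Fin n → ℝ) =>
        ∏ j, f j ((MeasurableEquiv.piFinSuccAbove (fun _ : Fin (n + 1) => ℝ) 0).symm p j))
        = fun p => f 0 p.1 * ∏ j : Fin n, f j.succ (p.2 j) := by
      funext p
      rw [Fin.prod_univ_succ]
      simp [MeasurableEquiv.piFinSuccAbove]
    rw [this]
    rw [show (volume : Measure (ℝ × ((j : Fin n) → ℝ)))
      = (volume : Measure ℝ).prod (volume : Measure (Fin n → ℝ)) from rfl, int_prod hm]
    have h2 : ∀ a, int volume (fun b : Fin n → ℝ => f 0 a * ∏ j : Fin n, f j.succ (b j))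
        = f 0 a * ∏ j : Fin n, int volume (f j.succ) := by
      intro a
      rw [int_const_mul, ih fun j => hf j.succ]
      exact Finset.measurable_fun_prod _ fun j _ => (hf j.succ).comp (measurable_pi_apply j)
    simp only [h2]
    rw [int_mul_const _ _ (hf 0), Fin.prod_univ_succ]

theorem int_indicator_of {μ : Measure A} {s : Set A} (hs : MeasurableSet s) {F : A → DomC}
    (h : ∀ a ∉ s, F a = of 0) : int μ F = int (μ.restrict s) F := by
  classical
  have h1 : ∫⁻ a, (F a).bd ∂μ = ∫⁻ a in s, (F a).bd ∂μ := by
    rw [← lintegral_indicator hs]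
    congr 1
    funext a
    by_cases ha : a ∈ s
    · simp [ha]
    · simp [ha, h a ha]
  refine ext h1 fun ht => ?_
  rw [val_int ht, val_int (by rwa [← h1]), ← integral_indicator hs]
  congr 1
  funext a
  by_cases ha : a ∈ s
  · simp [ha]
  · simp [ha, h a ha]

theorem int_image {s : Set ℝ} (hs : MeasurableSet s) {f f' : ℝ → ℝ}
    (hf' : ∀ x ∈ s, HasDerivWithinAt f (f' x) s x) (hf : Set.InjOn f s) (F : ℝ → DomC) :
    int (volume.restrict (f '' s)) F
      = int (volume.restrict s) fun x => of (|f' x| : ℝ) * F (f x) := by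
  have h1 : ∫⁻ a in f '' s, (F a).bd = ∫⁻ x in s, (of (|f' x| : ℝ) * F (f x)).bd := by
    rw [lintegral_image_eq_lintegral_abs_deriv_mul hs hf' hf]
    congr 1
    funext x
    rw [bd_mul, bd_of, ← ofReal_norm, Complex.norm_real, Real.norm_eq_abs, abs_abs]
  refine ext h1 fun ht => ?_
  rw [val_int ht, val_int (by rwa [← h1]), integral_image_eq_integral_abs_deriv_smul hs hf' hf]
  congr 1

/-- `d` represents the complex number `v`, unless its bound is infinite. -/
def Represents (d : DomC) (v : ℂ) : Prop := d.bd ≠ ∞ → d.val = v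

/-- If one factor has infinite bound while the product has not, the other factor has bound 0, so the
number it represents is 0. -/
theorem Represents.mul {d e : DomC} {v w : ℂ} (h : d.Represents v) (h' : e.Represents w) :
    (d * e).Represents (v * w) := by
  intro ht
  rw [bd_mul] at ht
  rw [val_mul]
  by_cases hd : d.bd = ∞
  · have he : e.bd = 0 := by
      by_contra he
      exact ht (by rw [hd, ENNReal.top_mul he])
    rw [← h' (by simp [he]), e.val_eq_zero_of_bd he]; simp
  · by_cases he : e.bd = ∞
    · have hd0 : d.bd = 0 := by
        by_contra hd
        exact ht (by rw [he, ENNReal.mul_top hd])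
      rw [← h hd, d.val_eq_zero_of_bd hd0]; simp
    · rw [h hd, h' he]

theorem represents_of (z : ℂ) : (of z).Represents z := fun _ => rfl

theorem ae_val_eq {μ : Measure A} {F : A → DomC} {f : A → ℂ} (hF : Measurable F)
    (h : ∀ a, (F a).Represents (f a)) (ht : ∫⁻ a, (F a).bd ∂μ ≠ ∞) :
    ∀ᵐ a ∂μ, (F a).val = f a := by
  filter_upwards [ae_lt_top (measurable_bd.comp hF) ht] with a ha
  exact h a ha.ne

/-- A finite integral of the bounds makes them finite almost everywhere, so divergent inner
integrals can occur only on a null set. -/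
theorem Represents.int {μ : Measure A} {F : A → DomC} {f : A → ℂ} (hF : Measurable F)
    (h : ∀ a, (F a).Represents (f a)) : (int μ F).Represents (∫ a, f a ∂μ) := by
  intro ht
  rw [val_int ht]
  exact integral_congr_ae (ae_val_eq hF h ht)

end DomC

end Toda

end

/-! ### One-variable integrals: Bessel, Gamma, Riemann-Liouville and Beta. -/

noncomputable section

namespace Toda

open scoped ENNReal
open DomC

/-- The exponential with values in the dominated complex numbers. -/
def ex (t : ℂ) : DomC := of (Complex.exp t)

theorem ex_add (s t : ℂ) : ex (s + t) = ex s * ex t := by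
  rw [ex, Complex.exp_add, map_mul]; rfl

@[simp] theorem ex_zero : ex 0 = 1 := by simp [ex]

theorem ex_sum {ι : Type*} (s : Finset ι) (f : ι → ℂ) : ex (∑ i ∈ s, f i) = ∏ i ∈ s, ex (f i) := by
  simp only [ex, Complex.exp_sum, map_prod]

@[fun_prop] theorem _root_.Measurable.domEx {A : Type*} [MeasurableSpace A] {f : A → ℂ}
    (h : Measurable f) : Measurable fun a => ex (f a) := by
  unfold ex; fun_prop

/-- The complex power of the positive part of a real number. -/
def pwp (x : ℝ) (s : ℂ) : ℂ := if 0 < x then Complex.exp (s * Real.log x) else 0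

theorem pwp_of_pos {x : ℝ} (h : 0 < x) (s : ℂ) : pwp x s = Complex.exp (s * Real.log x) := if_pos h

theorem pwp_of_nonpos {x : ℝ} (h : x ≤ 0) (s : ℂ) : pwp x s = 0 := if_neg h.not_gt

@[simp] theorem pwp_one (s : ℂ) : pwp 1 s = 1 := by simp [pwp]

theorem pwp_add (x : ℝ) (s t : ℂ) : pwp x (s + t) = pwp x s * pwp x t := by
  unfold pwp
  split_ifs
  · rw [add_mul, Complex.exp_add]
  · simp

theorem pwp_mul {x y : ℝ} (hx : 0 < x) (s : ℂ) : pwp (x * y) s = pwp x s * pwp y s := by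
  unfold pwp
  by_cases hy : 0 < y
  · rw [if_pos hx, if_pos hy, if_pos (mul_pos hx hy), Real.log_mul hx.ne' hy.ne',
      ← Complex.exp_add]
    push_cast; ring_nf
  · rw [if_neg hy, if_neg fun h => hy (pos_of_mul_pos_right h hx.le)]
    simp

theorem pwp_eq_cpow {x : ℝ} (hx : 0 < x) (s : ℂ) : pwp x s = (x : ℂ) ^ s := by
  rw [pwp_of_pos hx, Complex.cpow_def_of_ne_zero (by exact_mod_cast hx.ne'), Complex.ofReal_log hx.le,
    mul_comm]

@[fun_prop] theorem _root_.Measurable.pwp {A : Type*} [MeasurableSpace A] {f : A → ℝ}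
    (h : Measurable f) (s : ℂ) : Measurable fun a => pwp (f a) s := by
  unfold Toda.pwp
  exact Measurable.ite (measurableSet_lt measurable_const h) (by fun_prop) measurable_const

/-- The integral `∫ exp (c v - A e⁻ᵛ - B eᵛ) dv`. -/
def besselInt (c : ℂ) (A B : ℝ) : DomC :=
  int volume fun v : ℝ => ex (c * v - ((A * Real.exp (-v) + B * Real.exp v : ℝ) : ℂ))

/-- The dominated value of the Gamma function. -/
def gam (s : ℂ) : DomC := besselInt s 0 1

theorem int_sub_left (L : ℝ) (F : ℝ → DomC) :
    int volume F = int volume fun v => F (L - v) :=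
  int_map (e := MeasurableEquiv.subLeft L) (Measure.measurePreserving_sub_left volume L) F

theorem besselInt_swap (c : ℂ) (A B : ℝ) : besselInt c A B = besselInt (-c) B A := by
  rw [besselInt, int_sub_left 0]
  refine int_congr fun v => ?_
  simp only [zero_sub, neg_neg]
  congr 1; push_cast; ring

/-- The reflection v ↦ log A - log B - v interchanges the terms A e^{-v} and B e^v: the symmetry of
the Macdonald function in its index. -/
theorem besselInt_inv (c : ℂ) {A B : ℝ} (hA : 0 < A) (hB : 0 < B) :
    besselInt c A B = ex (c * (Real.log A - Real.log B)) * besselInt (-c) A B := by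
  rw [besselInt, besselInt, int_sub_left (Real.log A - Real.log B), ← int_const_mul _ _ (by fun_prop)]
  refine int_congr fun v => ?_
  rw [← ex_add]
  have h1 : A * Real.exp (-(Real.log A - Real.log B - v)) = B * Real.exp v := by
    rw [show -(Real.log A - Real.log B - v) = -Real.log A + Real.log B + v by ring, Real.exp_add,
      Real.exp_add, Real.exp_neg, Real.exp_log hA, Real.exp_log hB]
    field_simp
  have h2 : B * Real.exp (Real.log A - Real.log B - v) = A * Real.exp (-v) := by
    rw [show Real.log A - Real.log B - v = Real.log A + -Real.log B + -v by ring, Real.exp_add,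
      Real.exp_add, Real.exp_neg (Real.log B), Real.exp_log hA, Real.exp_log hB]
    field_simp
  rw [h1, h2]
  congr 1; push_cast; ring

theorem besselInt_zero_right (s : ℂ) {A : ℝ} (hA : 0 < A) :
    besselInt (-s) A 0 = ex (-s * Real.log A) * gam s := by
  rw [gam, besselInt, besselInt, int_sub_left (Real.log A), ← int_const_mul _ _ (by fun_prop)]
  refine int_congr fun v => ?_
  rw [← ex_add]
  have h1 : A * Real.exp (-(Real.log A - v)) = Real.exp v := by
    rw [show -(Real.log A - v) = -Real.log A + v by ring, Real.exp_add, Real.exp_neg,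
      Real.exp_log hA]
    field_simp
  rw [h1]
  congr 1; push_cast; ring

theorem besselInt_zero_left (s : ℂ) {B : ℝ} (hB : 0 < B) :
    besselInt s 0 B = ex (-s * Real.log B) * gam s := by
  rw [← besselInt_zero_right s hB, besselInt_swap]

/-- The Riemann-Liouville transform of a function `k` supported on the positive half line. -/
def rl (c : ℂ) (k : ℝ → ℂ) (q : ℝ) : DomC :=
  int volume fun τ : ℝ => of (pwp q c * pwp (1 - τ) (c - 1) * k (q * τ))

@[fun_prop] theorem measurable_rl (c : ℂ) {k : ℝ → ℂ} (hk : Measurable k) :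
    Measurable (rl c k) := by
  unfold rl
  fun_prop

/-- Substitute 1 - a e^{-z} = qτ. The support of `k` gives τ > 0 and the truncated power gives τ <
1. -/
theorem int_rl {a q : ℝ} (ha : 0 < a) (hq : 0 < q) (hq1 : q ≤ 1) (c : ℂ) {k : ℝ → ℂ}
    (hk : Measurable k) (hk0 : ∀ x ≤ 0, k x = 0) :
    int volume (fun z : ℝ => of (Complex.exp (-c * z) * pwp (1 - (1 - q) * Real.exp z / a) (c - 1)
        * k (1 - a * Real.exp (-z))))
      = ex (-c * Real.log a) * rl c k q := by
  set f : ℝ → ℝ := fun τ => Real.log a - Real.log (1 - q * τ) with hf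
  have hpos : ∀ τ ∈ Set.Ioo (0 : ℝ) 1, 0 < 1 - q * τ := fun τ hτ => by nlinarith [hτ.1, hτ.2]
  have hfe : ∀ τ ∈ Set.Ioo (0 : ℝ) 1, Real.exp (f τ) = a / (1 - q * τ) := fun τ hτ => by
    rw [hf]; simp only; rw [Real.exp_sub, Real.exp_log ha, Real.exp_log (hpos τ hτ)]
  have hfe' : ∀ τ ∈ Set.Ioo (0 : ℝ) 1, a * Real.exp (-f τ) = 1 - q * τ := fun τ hτ => by
    rw [Real.exp_neg, hfe τ hτ]; field_simp
  have hinj : Set.InjOn f (Set.Ioo 0 1) := fun x hx y hy h => by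
    have h1 := hfe' x hx
    rw [h, hfe' y hy] at h1
    nlinarith
  have hder : ∀ τ ∈ Set.Ioo (0 : ℝ) 1, HasDerivWithinAt f (q / (1 - q * τ)) (Set.Ioo 0 1) τ := by
    intro τ hτ
    have h1 : HasDerivAt (fun τ : ℝ => 1 - q * τ) (-q) τ := by
      simpa using ((hasDerivAt_id τ).const_mul q).const_sub 1
    have h2 := (h1.log (hpos τ hτ).ne').const_sub (Real.log a)
    exact (h2.congr_deriv (by rw [neg_div, neg_neg])).hasDerivWithinAt
  have hR : rl c k q = int (volume.restrict (Set.Ioo 0 1)) fun τ : ℝ =>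
      of (pwp q c * pwp (1 - τ) (c - 1) * k (q * τ)) := by
    refine int_indicator_of measurableSet_Ioo fun τ hτ => ?_
    by_cases h0 : 0 < τ
    · rw [pwp_of_nonpos (x := 1 - τ)]
      · simp
      · by_contra h1
        exact hτ ⟨h0, by linarith⟩
    · rw [hk0 (q * τ) (by nlinarith)]; simp
  rw [int_indicator_of (s := f '' Set.Ioo 0 1)
    (measurableSet_Ioo.image_of_continuousOn_injOn
      (fun τ hτ => (hder τ hτ).continuousWithinAt) hinj),
    int_image measurableSet_Ioo hder hinj, hR, ← int_const_mul _ _ (by fun_prop)]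
  · refine int_congr_ae ((ae_restrict_iff' measurableSet_Ioo).2 (.of_forall fun τ hτ => ?_))
    have hp := hpos τ hτ
    have hτ1 : 0 < 1 - τ := by linarith [hτ.2]
    rw [hfe τ hτ, hfe' τ hτ, abs_of_pos (div_pos hq hp), ex, ← map_mul, ← map_mul, sub_sub_cancel]
    have h1 : 1 - (1 - q) * (a / (1 - q * τ)) / a = q * (1 - τ) / (1 - q * τ) := by
      field_simp; ring
    rw [h1, pwp_of_pos (div_pos (mul_pos hq hτ1) hp), pwp_of_pos hq, pwp_of_pos hτ1,
      Real.log_div (mul_pos hq hτ1).ne' hp.ne', Real.log_mul hq.ne' hτ1.ne',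
      ← Real.exp_log (div_pos hq hp), Real.log_div hq.ne' hp.ne', Complex.ofReal_exp]
    congr 1
    simp only [← mul_assoc, ← Complex.exp_add]
    congr 2
    rw [hf]
    push_cast
    ring
  · intro z hz
    by_cases h0 : 0 < 1 - a * Real.exp (-z)
    · rw [pwp_of_nonpos (x := 1 - (1 - q) * Real.exp z / a)]
      · simp
      · by_contra! h1
        have h2 : (1 - q) * Real.exp z < a := by
          rw [sub_pos, div_lt_one ha] at h1; exact h1
        have h3 : 1 - q < a * Real.exp (-z) := by
          rw [Real.exp_neg, ← div_eq_mul_inv, lt_div_iff₀ (Real.exp_pos z)]; exact h2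
        refine hz ⟨(1 - a * Real.exp (-z)) / q, ⟨div_pos h0 hq, ?_⟩, ?_⟩
        · rw [div_lt_one hq]; linarith
        · rw [hf]
          simp only
          rw [mul_div_cancel₀ _ hq.ne', sub_sub_cancel, Real.log_mul ha.ne' (Real.exp_pos _).ne',
            Real.log_exp]
          ring
    · rw [hk0 _ (not_lt.1 h0)]; simp

/-- The substitution e^V = e^z + e^t absorbs the cut V > z. Read backwards, exp(-B e^z) is a
superposition of truncated powers. -/
theorem int_tail_eq_gam (c : ℂ) {B : ℝ} (hB : 0 < B) (z : ℝ) :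
    int volume (fun V : ℝ => of (Complex.exp (c * V - (B * Real.exp V : ℝ))
        * pwp (1 - Real.exp (z - V)) (c - 1)))
      = gam c * ex (-c * Real.log B) * ex (-(B * Real.exp z : ℝ)) := by
  set f : ℝ → ℝ := fun t => Real.log (Real.exp z + Real.exp t) with hf
  have hpos : ∀ t, 0 < Real.exp z + Real.exp t := fun t => by positivity
  have hfe : ∀ t, Real.exp (f t) = Real.exp z + Real.exp t := fun t => Real.exp_log (hpos t)
  have hinj : Set.InjOn f Set.univ := fun x _ y _ h => by
    have h1 := hfe x
    rw [h, hfe y] at h1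
    exact Real.exp_injective (by linarith)
  have hder : ∀ t ∈ Set.univ, HasDerivWithinAt f
      (Real.exp t / (Real.exp z + Real.exp t)) Set.univ t := fun t _ =>
    (((Real.hasDerivAt_exp t).const_add (Real.exp z)).log (hpos t).ne').hasDerivWithinAt
  rw [int_indicator_of (s := f '' Set.univ)
    (MeasurableSet.univ.image_of_continuousOn_injOn
      (fun t ht => (hder t ht).continuousWithinAt) hinj),
    int_image MeasurableSet.univ hder hinj, Measure.restrict_univ, mul_comm (gam c),
    ← besselInt_zero_left c hB, besselInt, ← int_mul_const _ _ (by fun_prop)]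
  · refine int_congr fun t => ?_
    have h1 : 1 - Real.exp (z - f t) = Real.exp t / (Real.exp z + Real.exp t) := by
      rw [Real.exp_sub, hfe]; field_simp [(hpos t).ne']; ring
    have h2 : 0 < Real.exp t / (Real.exp z + Real.exp t) := div_pos (Real.exp_pos t) (hpos t)
    rw [h1, hfe, abs_of_pos h2, pwp_of_pos h2, ex, ex, ← map_mul, ← map_mul]
    have h3 : ((Real.exp t / (Real.exp z + Real.exp t) : ℝ) : ℂ)
        = Complex.exp ((t - f t : ℝ)) := by
      rw [← Complex.ofReal_exp, Real.exp_sub, hfe]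
    rw [h3, Real.log_div (Real.exp_pos t).ne' (hpos t).ne', Real.log_exp]
    congr 1
    simp only [← Complex.exp_add]
    congr 1
    rw [hf]
    push_cast
    ring
  · intro V hV
    rw [pwp_of_nonpos]
    · simp
    · by_contra! h1
      have h2 : z < V := by
        rw [sub_pos, Real.exp_lt_one_iff] at h1; linarith
      have h3 : Real.exp z < Real.exp V := Real.exp_lt_exp.2 h2
      refine hV ⟨Real.log (Real.exp V - Real.exp z), trivial, ?_⟩
      rw [hf]
      simp only
      rw [Real.exp_log (by linarith), add_sub_cancel, Real.log_exp]

/-- Expand exp(-B e^z) by `int_tail_eq_gam` and exchange the integrals; the inner integral over z is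
then the fractional integral of `int_rl` with q = 1 - a e^{-V}. -/
theorem gam_mul_int {a B : ℝ} (ha : 0 < a) (hB : 0 < B) (c : ℂ) {k : ℝ → ℂ}
    (hk : Measurable k) (hk0 : ∀ x ≤ 0, k x = 0) :
    gam c * ex (-c * Real.log B) * int volume (fun z : ℝ =>
        ex (-c * z - (B * Real.exp z : ℝ)) * of (k (1 - a * Real.exp (-z))))
      = ex (-c * Real.log a) * int volume (fun V : ℝ =>
        ex (c * V - (B * Real.exp V : ℝ)) * rl c k (1 - a * Real.exp (-V))) := by
  have h1 : ∀ z : ℝ, gam c * ex (-c * Real.log B) *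
      (ex (-c * z - (B * Real.exp z : ℝ)) * of (k (1 - a * Real.exp (-z))))
      = int volume fun V : ℝ => of (Complex.exp (c * V - (B * Real.exp V : ℝ))
        * pwp (1 - Real.exp (z - V)) (c - 1)) * (ex (-c * z) * of (k (1 - a * Real.exp (-z)))) := by
    intro z
    rw [int_mul_const _ _ (by fun_prop), int_tail_eq_gam c hB, sub_eq_add_neg, ex_add]
    simp only [mul_assoc, mul_left_comm]
  rw [← int_const_mul _ _ (by fun_prop), int_congr h1, int_swap (by fun_prop),
    ← int_const_mul _ _ (by fun_prop)]
  refine int_congr fun V => ?_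
  have hm : Measurable fun z : ℝ => of (Complex.exp (-c * z)
      * pwp (1 - Real.exp (z - V)) (c - 1) * k (1 - a * Real.exp (-z))) := by fun_prop
  have h2 : ∀ z : ℝ, of (Complex.exp (c * V - (B * Real.exp V : ℝ))
        * pwp (1 - Real.exp (z - V)) (c - 1)) * (ex (-c * z) * of (k (1 - a * Real.exp (-z))))
      = ex (c * V - (B * Real.exp V : ℝ)) * of (Complex.exp (-c * z)
        * pwp (1 - Real.exp (z - V)) (c - 1) * k (1 - a * Real.exp (-z))) := by
    intro z
    simp only [ex, ← map_mul]
    congr 1; ring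
  rw [int_congr h2, int_const_mul _ _ hm, mul_left_comm]
  congr 1
  by_cases hq : 0 < 1 - a * Real.exp (-V)
  · rw [← int_rl ha hq (by linarith [mul_pos ha (Real.exp_pos (-V))]) c hk hk0]
    refine int_congr fun z => ?_
    rw [sub_sub_cancel, show a * Real.exp (-V) * Real.exp z / a = Real.exp (z - V) by
      rw [sub_eq_add_neg, Real.exp_add]; field_simp]
  -- For q ≤ 0 both sides vanish: `k` requires e^{-z} < 1/a ≤ e^{-V}, that is z > V, where the
  -- truncated power is 0.
  · have h3 : rl c k (1 - a * Real.exp (-V)) = of 0 * rl c k (1 - a * Real.exp (-V)) := by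
      rw [rl, ← int_const_mul _ _ (by fun_prop)]
      refine int_congr fun τ => ?_
      rw [pwp_of_nonpos (not_lt.1 hq)]; simp [← map_mul]
    rw [h3, mul_left_comm, of_zero_mul, ← of_zero_mul (int volume fun z : ℝ =>
      of (Complex.exp (-c * z) * pwp (1 - Real.exp (z - V)) (c - 1)
        * k (1 - a * Real.exp (-z)))), ← int_const_mul _ _ hm]
    refine int_congr fun z => ?_
    rw [of_zero_mul]
    by_cases h0 : 0 < 1 - a * Real.exp (-z)
    · rw [pwp_of_nonpos (x := 1 - Real.exp (z - V))]
      · simp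
      · have h4 : Real.exp (-z) ≤ Real.exp (-V) := by
          have : a * Real.exp (-z) ≤ a * Real.exp (-V) := by linarith
          exact le_of_mul_le_mul_left this ha
        rw [Real.exp_le_exp] at h4
        rw [sub_nonpos, Real.one_le_exp_iff]
        linarith
    · rw [hk0 _ (not_lt.1 h0)]; simp

/-- The dominated value of the Beta function. -/
def bet (c e : ℂ) : DomC := int volume fun τ : ℝ => of (pwp (1 - τ) (c - 1) * pwp τ (e - 1))

/-- A power scales out of the fractional integral, leaving a Beta integral; this is the source of
Γ(g + σ) in the denominator. -/
theorem rl_pwp (c e : ℂ) (q : ℝ) :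
    rl c (fun x => pwp x (e - 1)) q = of (pwp q (c + e - 1)) * bet c e := by
  rw [rl, bet, ← int_const_mul _ _ (by fun_prop)]
  refine int_congr fun τ => ?_
  rw [← map_mul]
  congr 1
  by_cases hq : 0 < q
  · rw [pwp_mul hq, show c + e - 1 = c + (e - 1) by ring, pwp_add]; ring
  · simp [pwp_of_nonpos (not_lt.1 hq)]

theorem bd_int_of_ne_top {A : Type*} [MeasurableSpace A] {μ : Measure A} {f : A → ℂ}
    (hf : Integrable f μ) : (int μ fun a => of (f a)).bd ≠ ∞ := hf.2.ne

theorem val_int_of {A : Type*} [MeasurableSpace A] {μ : Measure A} {f : A → ℂ}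
    (hf : Integrable f μ) : (int μ fun a => of (f a)).val = ∫ a, f a ∂μ := val_int hf.2.ne

theorem gam_eq_int (s : ℂ) : gam s = int (volume.restrict (Set.Ioi 0)) fun y : ℝ =>
    of ((Real.exp (-y) : ℝ) * (y : ℂ) ^ (s - 1)) := by
  have h := int_image MeasurableSet.univ (f := Real.exp) (f' := Real.exp)
    (fun x _ => (Real.hasDerivAt_exp x).hasDerivWithinAt) Real.exp_injective.injOn
    (fun y : ℝ => of ((Real.exp (-y) : ℝ) * (y : ℂ) ^ (s - 1)))
  rw [Set.image_univ, Real.range_exp] at h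
  rw [h, gam, besselInt, Measure.restrict_univ]
  refine int_congr fun v => ?_
  rw [ex, ← map_mul, ← pwp_eq_cpow (Real.exp_pos v), pwp_of_pos (Real.exp_pos v), Real.log_exp,
    abs_of_pos (Real.exp_pos v), Complex.ofReal_exp, Complex.ofReal_exp, ← Complex.exp_add,
    ← Complex.exp_add]
  congr 2
  push_cast
  ring

theorem bd_gam_ne_top {s : ℂ} (hs : 0 < s.re) : (gam s).bd ≠ ∞ := by
  rw [gam_eq_int]
  exact bd_int_of_ne_top (Complex.GammaIntegral_convergent hs)

theorem val_gam {s : ℂ} (hs : 0 < s.re) : (gam s).val = Complex.Gamma s := by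
  rw [gam_eq_int, val_int_of (Complex.GammaIntegral_convergent hs), Complex.Gamma_eq_integral hs,
    Complex.GammaIntegral]

/-- Needed to cancel Gamma factors in the bounds; a zero bound would give Γ(s) = 0. -/
theorem bd_gam_ne_zero {s : ℂ} (hs : 0 < s.re) : (gam s).bd ≠ 0 := by
  intro h
  exact Complex.Gamma_ne_zero_of_re_pos hs (by rw [← val_gam hs, val_eq_zero_of_bd _ h])

theorem bet_eq_int (c e : ℂ) : bet c e = int (volume.restrict (Set.Ioc 0 1)) fun τ : ℝ =>
    of ((τ : ℂ) ^ (e - 1) * (1 - (τ : ℂ)) ^ (c - 1)) := by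
  rw [bet, int_indicator_of (measurableSet_Ioo (a := (0 : ℝ)) (b := 1)),
    restrict_Ioo_eq_restrict_Ioc]
  · rw [← restrict_Ioo_eq_restrict_Ioc]
    refine int_congr_ae ((ae_restrict_iff' measurableSet_Ioo).2 (.of_forall fun τ hτ => ?_))
    rw [pwp_eq_cpow (by linarith [hτ.2]), pwp_eq_cpow hτ.1, mul_comm]
    push_cast
    rfl
  · intro τ hτ
    by_cases h0 : 0 < τ
    · rw [pwp_of_nonpos (x := 1 - τ), zero_mul]
      by_contra h1
      exact hτ ⟨h0, by linarith⟩
    · rw [pwp_of_nonpos (not_lt.1 h0), mul_zero]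

theorem bd_bet_ne_top {c e : ℂ} (hc : 0 < c.re) (he : 0 < e.re) : (bet c e).bd ≠ ∞ := by
  rw [bet_eq_int]
  exact bd_int_of_ne_top ((intervalIntegrable_iff_integrableOn_Ioc_of_le zero_le_one).1
    (Complex.betaIntegral_convergent he hc))

theorem val_bet {c e : ℂ} (hc : 0 < c.re) (he : 0 < e.re) :
    (bet c e).val = Complex.Gamma c * Complex.Gamma e / Complex.Gamma (c + e) := by
  rw [bet_eq_int, val_int_of ((intervalIntegrable_iff_integrableOn_Ioc_of_le zero_le_one).1
    (Complex.betaIntegral_convergent he hc)), ← intervalIntegral.integral_of_le zero_le_one,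
    mul_comm (Complex.Gamma c), Complex.Gamma_mul_Gamma_eq_betaIntegral he hc, add_comm c e,
    mul_div_cancel_left₀ _ (Complex.Gamma_ne_zero_of_re_pos (by simpa using add_pos he hc)),
    Complex.betaIntegral]

end Toda

end

/-! ### Interlacing kernels and their factorization. -/

noncomputable section

namespace Toda

open scoped ENNReal
open DomC Finset

/-- The coordinates of a finite sequence, continued by `0`. -/
def cd {m : ℕ} (y : Fin m → ℝ) (j : ℕ) : ℝ := if h : j < m then y ⟨j, h⟩ else 0

/-- The exponentials of the coordinates of a finite sequence, continued by `0`. -/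
def ep {m : ℕ} (y : Fin m → ℝ) (j : ℕ) : ℝ := if h : j < m then Real.exp (y ⟨j, h⟩) else 0

/-- The inverse exponentials of the coordinates of a finite sequence, continued by `0`. -/
def em {m : ℕ} (y : Fin m → ℝ) (j : ℕ) : ℝ := if h : j < m then Real.exp (-y ⟨j, h⟩) else 0

section coordinates

variable {m n : ℕ}

theorem ep_of_lt (y : Fin m → ℝ) {j : ℕ} (h : j < m) : ep y j = Real.exp (cd y j) := by
  simp [ep, cd, h]

theorem em_of_lt (y : Fin m → ℝ) {j : ℕ} (h : j < m) : em y j = Real.exp (-cd y j) := by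
  simp [em, cd, h]

theorem cd_of_le (y : Fin m → ℝ) {j : ℕ} (h : m ≤ j) : cd y j = 0 := dif_neg h.not_gt

theorem ep_of_le (y : Fin m → ℝ) {j : ℕ} (h : m ≤ j) : ep y j = 0 := dif_neg h.not_gt

theorem em_of_le (y : Fin m → ℝ) {j : ℕ} (h : m ≤ j) : em y j = 0 := dif_neg h.not_gt

@[simp] theorem cd_fin (y : Fin m → ℝ) (j : Fin m) : cd y j = y j := by simp [cd]

@[simp] theorem ep_fin (y : Fin m → ℝ) (j : Fin m) : ep y j = Real.exp (y j) := by simp [ep]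

@[simp] theorem em_fin (y : Fin m → ℝ) (j : Fin m) : em y j = Real.exp (-y j) := by simp [em]

theorem ep_nonneg (y : Fin m → ℝ) (j : ℕ) : 0 ≤ ep y j := by
  unfold ep; split_ifs <;> positivity

theorem em_nonneg (y : Fin m → ℝ) (j : ℕ) : 0 ≤ em y j := by
  unfold em; split_ifs <;> positivity

@[fun_prop] theorem _root_.Measurable.todaEp {A : Type*} [MeasurableSpace A] {f : A → Fin m → ℝ}
    (h : Measurable f) (j : ℕ) : Measurable fun a => ep (f a) j := by
  unfold ep
  split_ifs <;> fun_prop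

@[fun_prop] theorem _root_.Measurable.todaEm {A : Type*} [MeasurableSpace A] {f : A → Fin m → ℝ}
    (h : Measurable f) (j : ℕ) : Measurable fun a => em (f a) j := by
  unfold em
  split_ifs <;> fun_prop

theorem sum_range_cd (y : Fin m → ℝ) (hmn : m ≤ n) : ∑ j ∈ range n, cd y j = ∑ j, y j := by
  rw [← sum_subset (range_subset_range.2 hmn), sum_range]
  · simp
  · intro j _ hj
    exact cd_of_le y (by simpa using hj)

theorem sum_range_cd_succ (y : Fin m → ℝ) (hmn : m ≤ n + 1) :
    ∑ j ∈ range n, cd y (j + 1) = ∑ j, y j - cd y 0 := by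
  rw [← sum_range_cd y hmn, sum_range_succ']
  ring

end coordinates

/-- The interaction of two interlacing sequences. -/
def wexp {m n : ℕ} (z : Fin n → ℝ) (y : Fin m → ℝ) : ℝ :=
  ∑ j ∈ range n, (ep z j * em y j + ep y j * em z (j + 1))

/-- The common kernel of the raising operator and the Baxter operator of the `GL` Toda chain. -/
def w {m n : ℕ} (τ : ℂ) (z : Fin n → ℝ) (y : Fin m → ℝ) : DomC :=
  ex (τ * ((∑ j, z j - ∑ j, y j : ℝ) : ℂ) - (wexp z y : ℝ))

/-- The boundary variable `1 - a exp (-y₀)`, equal to `1` if there are no coordinates. -/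
def gate {m : ℕ} (a : ℝ) (y : Fin m → ℝ) : ℝ := 1 - a * em y 0

/-- The boundary factor `exp (a exp (-y₀))`. -/
def wall {m : ℕ} (a : ℝ) (y : Fin m → ℝ) : DomC := ex ((a * em y 0 : ℝ) : ℂ)

section measurability

variable {m n : ℕ} {A : Type*} [MeasurableSpace A]

@[fun_prop] theorem _root_.Measurable.todaW (τ : ℂ) {f : A → Fin n → ℝ} {g : A → Fin m → ℝ}
    (hf : Measurable f) (hg : Measurable g) : Measurable fun a => w τ (f a) (g a) := by
  unfold w wexp
  fun_prop

@[fun_prop] theorem _root_.Measurable.todaGate (a : ℝ) {f : A → Fin n → ℝ}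
    (hf : Measurable f) : Measurable fun x => gate a (f x) := by
  unfold gate
  fun_prop

@[fun_prop] theorem _root_.Measurable.todaWall (a : ℝ) {f : A → Fin n → ℝ}
    (hf : Measurable f) : Measurable fun x => wall a (f x) := by
  unfold wall
  fun_prop

end measurability

section factorization

variable {m n p : ℕ}

theorem wexp_lower (z : Fin n → ℝ) (y : Fin m → ℝ) (h : m ≤ n) :
    wexp z y = ∑ j : Fin m, (ep z j * Real.exp (-y j) + em z (j + 1) * Real.exp (y j)) := by
  rw [wexp, ← sum_subset (range_subset_range.2 h), sum_range]
  · refine sum_congr rfl fun j _ => ?_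
    rw [ep_fin, em_fin]; ring
  · intro j _ hj
    have hj : m ≤ j := by simpa using hj
    rw [ep_of_le y hj, em_of_le y hj]; ring

/-- The coordinate z_0 has no decreasing exponential. It is split off because the boundary factor
sits on it. -/
theorem wexp_upper (z : Fin (n + 1) → ℝ) (y : Fin m → ℝ) :
    wexp z y = em y 0 * Real.exp (z 0)
      + ∑ j : Fin n, (ep y j * Real.exp (-z j.succ) + em y (j + 1) * Real.exp (z j.succ)) := by
  rw [wexp, sum_add_distrib, sum_range_succ', sum_range_succ (fun j => ep y j * em z (j + 1)),
    em_of_le z le_rfl, sum_range, sum_range, sum_add_distrib]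
  have h1 : ∀ j : Fin n, ep z (j + 1) = Real.exp (z j.succ) := fun j => ep_fin z j.succ
  have h2 : ∀ j : Fin n, em z (j + 1) = Real.exp (-z j.succ) := fun j => em_fin z j.succ
  have h3 : ep z 0 = Real.exp (z 0) := ep_fin z 0
  simp only [h1, h2, h3, mul_comm (em y _)]
  ring

/-- The exponentials of the coordinates, shifted by one place. -/
def eps (y : Fin m → ℝ) : ℕ → ℝ
  | 0 => 0
  | j + 1 => ep y j

theorem wexp_upper' (z : Fin n → ℝ) (y : Fin m → ℝ) :
    wexp z y = ∑ j : Fin n, (eps y j * Real.exp (-z j) + em y j * Real.exp (z j)) := by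
  cases n with
  | zero => simp [wexp]
  | succ n =>
    rw [wexp_upper, Fin.sum_univ_succ]
    simp [eps]

/-- The coefficients at the inverse exponentials in a lower position. -/
def lowA (a : ℝ) (z : Fin n → ℝ) (u : Fin p → ℝ) (j : ℕ) : ℝ :=
  ep z j + ep u j - if j = 0 then a else 0

/-- The coordinates y_j do not interact with each other, so the integral factors. The wall has the
sign opposite to the interaction and only lowers the first coefficient by a. -/
theorem int_lower (a : ℝ) (α β : ℂ) (z : Fin n → ℝ) (u : Fin p → ℝ) (hn : m ≤ n) (hp : m ≤ p) :
    int volume (fun y : Fin m → ℝ => w α z y * wall a y * w β u y)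
      = ex (α * (∑ j, z j : ℝ) + β * (∑ j, u j : ℝ)) * ∏ j ∈ range m,
        besselInt (-(α + β)) (lowA a z u j) (em z (j + 1) + em u (j + 1)) := by
  rw [prod_range]
  simp only [besselInt]
  rw [← int_fin_prod fun j => by fun_prop, ← int_const_mul]
  swap
  · exact measurable_fun_prod _ fun j _ => by fun_prop
  refine int_congr fun y => ?_
  rw [w, w, wall, ← ex_sum, ← ex_add, ← ex_add, ← ex_add, wexp_lower z y hn, wexp_lower u y hp]
  congr 1
  -- The wall is spread over all coordinates with zero weight beyond the first; for m = 0 both sides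
  -- are 0.
  have h1 : a * em y 0 = ∑ j : Fin m, (if (j : ℕ) = 0 then a else 0) * Real.exp (-y j) := by
    cases m with
    | zero => simp [em]
    | succ m => rw [Fin.sum_univ_succ]; simp [em]
  rw [h1, sum_sub_distrib, ← mul_sum]
  have h2 : ∑ j : Fin m, ((lowA a z u j * Real.exp (-y j)
        + (em z (j + 1) + em u (j + 1)) * Real.exp (y j) : ℝ) : ℂ)
      = ((∑ j : Fin m, (ep z j * Real.exp (-y j) + em z (j + 1) * Real.exp (y j))
        + ∑ j : Fin m, (ep u j * Real.exp (-y j) + em u (j + 1) * Real.exp (y j))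
        - ∑ j : Fin m, (if (j : ℕ) = 0 then a else 0) * Real.exp (-y j) : ℝ) : ℂ) := by
    rw [← Complex.ofReal_sum, ← sum_add_distrib, ← sum_sub_distrib]
    congr 1
    refine sum_congr rfl fun j _ => ?_
    rw [lowA]; ring
  rw [h2, ← Complex.ofReal_sum]
  simp only [Complex.ofReal_sub, Complex.ofReal_add]
  ring

theorem int_upper {q : ℕ} (a : ℝ) (α β : ℂ) (x : Fin p → ℝ) (v : Fin q → ℝ) {k : ℝ → DomC}
    (hk : Measurable k) :
    int volume (fun z : Fin (m + 1) → ℝ => w α z x * k (gate a z) * w β z v)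
      = ex (-α * (∑ j, x j : ℝ) - β * (∑ j, v j : ℝ))
        * int volume (fun t : ℝ => ex ((α + β) * t - ((em x 0 + em v 0) * Real.exp t : ℝ))
          * k (1 - a * Real.exp (-t)))
        * ∏ j ∈ range m,
          besselInt (α + β) (lowA 0 x v j) (em x (j + 1) + em v (j + 1)) := by
  rw [prod_range]
  simp only [besselInt]
  -- The boundary coordinate carries `k` and keeps its own integrand; the others give Bessel
  -- integrals.
  set f : Fin (m + 1) → ℝ → DomC := Fin.cons
    (fun t : ℝ => ex ((α + β) * t - ((em x 0 + em v 0) * Real.exp t : ℝ))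
          * k (1 - a * Real.exp (-t)))
    (fun j t => ex ((α + β) * t - (lowA 0 x v j * Real.exp (-t)
      + (em x (j + 1) + em v (j + 1)) * Real.exp t : ℝ))) with hf
  have hfm : ∀ j, Measurable (f j) := by
    intro j
    refine Fin.cases ?_ (fun j => ?_) j
    · rw [hf, Fin.cons_zero]; fun_prop
    · rw [hf, Fin.cons_succ]; fun_prop
  have h := int_fin_prod hfm
  rw [Fin.prod_univ_succ (fun j => int volume (f j))] at h
  simp only [hf, Fin.cons_zero, Fin.cons_succ] at h
  rw [mul_assoc, ← h, ← int_const_mul]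
  swap
  · exact measurable_fun_prod _ fun j _ => (hfm j).comp (measurable_pi_apply j)
  refine int_congr fun z => ?_
  rw [Fin.prod_univ_succ]
  simp only [Fin.cons_zero, Fin.cons_succ]
  have hg : gate a z = 1 - a * Real.exp (-z 0) := by rw [gate, ← em_fin z 0]; rfl
  rw [hg, w, w, ← ex_sum, mul_right_comm, ← ex_add, mul_right_comm (ex _) (k _), ← mul_assoc (ex _),
    ← ex_add, ← ex_add]
  congr 2
  rw [wexp_upper, wexp_upper, sum_sub_distrib, ← mul_sum, Fin.sum_univ_succ z]
  have h2 : ∑ j : Fin m, ((lowA 0 x v j * Real.exp (-z j.succ)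
        + (em x (j + 1) + em v (j + 1)) * Real.exp (z j.succ) : ℝ) : ℂ)
      = ((∑ j : Fin m, (ep x j * Real.exp (-z j.succ) + em x (j + 1) * Real.exp (z j.succ))
        + ∑ j : Fin m, (ep v j * Real.exp (-z j.succ) + em v (j + 1) * Real.exp (z j.succ)) : ℝ)
          : ℂ) := by
    rw [← Complex.ofReal_sum, ← sum_add_distrib]
    congr 1
    refine sum_congr rfl fun j _ => ?_
    simp only [lowA, ite_self]; ring
  rw [h2, ← Complex.ofReal_sum]
  simp only [Complex.ofReal_sub, Complex.ofReal_add, Complex.ofReal_mul]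
  ring

/-- Here x lies below z and above y, so y enters with its exponentials shifted by one place. -/
theorem int_middle (α β : ℂ) (z : Fin n → ℝ) (y : Fin p → ℝ) (hn : m ≤ n) :
    int volume (fun x : Fin m → ℝ => w α z x * w β x y)
      = ex (α * (∑ j, z j : ℝ) - β * (∑ j, y j : ℝ)) * ∏ j ∈ range m,
        besselInt (β - α) (ep z j + eps y j) (em z (j + 1) + em y j) := by
  rw [prod_range]
  simp only [besselInt]
  rw [← int_fin_prod fun j => by fun_prop, ← int_const_mul]
  swap
  · exact measurable_fun_prod _ fun j _ => by fun_prop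
  refine int_congr fun x => ?_
  rw [w, w, ← ex_sum, ← ex_add, ← ex_add, wexp_lower z x hn, wexp_upper' x y]
  congr 1
  rw [sum_sub_distrib, ← mul_sum]
  have h2 : ∑ j : Fin m, (((ep z j + eps y j) * Real.exp (-x j)
        + (em z (j + 1) + em y j) * Real.exp (x j) : ℝ) : ℂ)
      = ((∑ j : Fin m, (ep z j * Real.exp (-x j) + em z (j + 1) * Real.exp (x j))
        + ∑ j : Fin m, (eps y j * Real.exp (-x j) + em y j * Real.exp (x j)) : ℝ) : ℂ) := by
    rw [← Complex.ofReal_sum, ← sum_add_distrib]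
    congr 1
    refine sum_congr rfl fun j _ => ?_
    ring
  rw [h2, ← Complex.ofReal_sum]
  simp only [Complex.ofReal_sub, Complex.ofReal_add]
  ring

end factorization

/-! ### Telescoping products of Bessel integrals. -/

section chains

/-- Each inversion costs exp(c(log A_j - log B_j)) = exp(c(L_j - L_{j+1} + r_j)), and the L_j
telescope. -/
theorem prod_besselInt_chain (c : ℂ) (m : ℕ) {A B L r : ℕ → ℝ} (hA : ∀ j < m, 0 < A j)
    (hB : ∀ j < m, 0 < B j) (hL : ∀ j < m, Real.log (A j) = L j)
    (hLB : ∀ j < m, Real.log (B j) = L (j + 1) - r j) :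
    ∏ j ∈ range m, besselInt c (A j) (B j)
      = ex (c * (L 0 - L m + ∑ j ∈ range m, r j : ℝ)) *
        ∏ j ∈ range m, besselInt (-c) (A j) (B j) := by
  induction m with
  | zero => simp
  | succ m ih =>
    rw [prod_range_succ, prod_range_succ, ih (fun j h => hA j (by omega))
      (fun j h => hB j (by omega)) (fun j h => hL j (by omega)) (fun j h => hLB j (by omega)),
      besselInt_inv c (hA m (by omega)) (hB m (by omega)), mul_mul_mul_comm, ← ex_add,
      hL m (by omega), hLB m (by omega), sum_range_succ]
    congr 2
    push_cast
    ring

theorem log_exp_neg_add (x y : ℝ) :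
    Real.log (Real.exp (-x) + Real.exp (-y)) = Real.log (Real.exp x + Real.exp y) - (x + y) := by
  have h : Real.exp (-x) + Real.exp (-y) = (Real.exp x + Real.exp y) / Real.exp (x + y) := by
    rw [Real.exp_neg, Real.exp_neg, Real.exp_add]
    field_simp; ring
  rw [h, Real.log_div (by positivity) (by positivity), Real.log_exp]

variable {m n p : ℕ}

/-- The boundary interaction of two sequences. -/
def coup (a : ℝ) (x : Fin n → ℝ) (v : Fin p → ℝ) : ℝ := em x 0 + em v 0 - a * em x 0 * em v 0

/-- Through this form the coupling becomes the factor 1 - pq of two boundary variables. -/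
theorem coup_eq {a : ℝ} (ha : a ≠ 0) (x : Fin n → ℝ) (v : Fin p → ℝ) :
    coup a x v = (1 - gate a x * gate a v) / a := by
  rw [coup, gate, gate]; field_simp; ring

theorem coup_eq_mul (a : ℝ) (x : Fin n → ℝ) (v : Fin p → ℝ) (hn : 0 < n) (hp : 0 < p) :
    coup a x v = lowA a x v 0 * Real.exp (-(cd x 0 + cd v 0)) := by
  rw [coup, lowA, em_of_lt x hn, em_of_lt v hp, ep_of_lt x hn, ep_of_lt v hp, neg_add, Real.exp_add,
    Real.exp_neg, Real.exp_neg]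
  field_simp
  simp
  ring

theorem log_lowA_zero {a : ℝ} {x : Fin n → ℝ} {v : Fin p → ℝ} (h : 0 < coup a x v) (hn : 0 < n)
    (hp : 0 < p) : 0 < lowA a x v 0 ∧
      Real.log (lowA a x v 0) = Real.log (coup a x v) + cd x 0 + cd v 0 := by
  rw [coup_eq_mul a x v hn hp] at h ⊢
  have h1 := pos_of_mul_pos_left h (Real.exp_pos _).le
  refine ⟨h1, ?_⟩
  rw [Real.log_mul h1.ne' (Real.exp_pos _).ne', Real.log_exp]
  ring

theorem lowA_pos {a : ℝ} {x : Fin n → ℝ} {v : Fin p → ℝ} (h : 0 < coup a x v) {j : ℕ} (hn : j < n)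
    (hp : j < p) : 0 < lowA a x v j := by
  rcases Nat.eq_zero_or_pos j with rfl | hj
  · exact (log_lowA_zero h hn hp).1
  · rw [lowA, if_neg hj.ne', sub_zero, ep_of_lt x hn, ep_of_lt v hp]
    positivity

theorem lowA_succ (a : ℝ) (x : Fin n → ℝ) (v : Fin p → ℝ) (j : ℕ) :
    lowA a x v (j + 1) = ep x (j + 1) + ep v (j + 1) := by simp [lowA]

theorem log_em_add (a : ℝ) (x : Fin n → ℝ) (v : Fin p → ℝ) {j : ℕ} (hn : j + 1 < n)
    (hp : j + 1 < p) : Real.log (em x (j + 1) + em v (j + 1))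
      = Real.log (lowA a x v (j + 1)) - (cd x (j + 1) + cd v (j + 1)) := by
  rw [lowA_succ, em_of_lt x hn, em_of_lt v hp, ep_of_lt x hn, ep_of_lt v hp, log_exp_neg_add]

/-- Since `x` has one coordinate more than `v`, every integral in the chain has B_j > 0 and can be
inverted; no Gamma function appears. -/
theorem prod_besselInt_of_lt {a : ℝ} (c : ℂ) {x : Fin (m + 1) → ℝ} {v : Fin m → ℝ}
    (h : 0 < coup a x v) :
    ∏ j ∈ range m, besselInt c (lowA a x v j) (em x (j + 1) + em v (j + 1))
      = ex (c * (Real.log (coup a x v) + ∑ j, x j + ∑ j, v j : ℝ)) *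
        ∏ j ∈ range m, besselInt (-c) (lowA a x v j) (em x (j + 1) + em v (j + 1)) := by
  -- The value 0 at j = m is right because the last B_j is e^{-x_m} alone, `v` having no coordinate
  -- m.
  rw [prod_besselInt_chain c m (L := fun j => if j < m then Real.log (lowA a x v j) else 0)
    (r := fun j => cd x (j + 1) + cd v (j + 1))]
  · congr 3
    congr 1
    rw [sum_add_distrib, sum_range_cd_succ x le_rfl, sum_range_cd_succ v (by omega)]
    simp only [lt_irrefl, if_false]
    split_ifs with hm
    · rw [(log_lowA_zero h (by omega) hm).2]; ring
    · obtain rfl : m = 0 := by omega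
      rw [coup, em_of_lt x zero_lt_one, em_of_le v le_rfl, cd_of_le v le_rfl]
      simp [cd]
  · intro j hj
    exact lowA_pos h (by omega) hj
  · intro j hj
    rw [em_of_lt x (by omega)]
    exact add_pos_of_pos_of_nonneg (Real.exp_pos _) (em_nonneg _ _)
  · intro j hj
    rw [if_pos hj]
  · intro j hj
    split_ifs with h1
    · exact log_em_add a x v (by omega) h1
    · rw [em_of_lt x (by omega), em_of_le v (by omega), cd_of_le v (by omega)]
      simp

/-- With equal lengths the last B_j is 0, so the last integral degenerates to a Gamma function and
the chain shortens by one. -/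
theorem prod_besselInt_of_eq {a : ℝ} (s : ℂ) {x v : Fin (m + 1) → ℝ} (h : 0 < coup a x v) :
    ∏ j ∈ range (m + 1), besselInt (-s) (lowA a x v j) (em x (j + 1) + em v (j + 1))
      = gam s * ex (-s * (Real.log (coup a x v) + ∑ j, x j + ∑ j, v j : ℝ)) *
        ∏ j ∈ range m, besselInt s (lowA a x v j) (em x (j + 1) + em v (j + 1)) := by
  rw [prod_range_succ, prod_besselInt_chain (-s) m (L := fun j => Real.log (lowA a x v j))
    (r := fun j => cd x (j + 1) + cd v (j + 1)), em_of_le x le_rfl, em_of_le v le_rfl, add_zero,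
    besselInt_zero_right s (lowA_pos h (by omega) (by omega)), neg_neg]
  · rw [(log_lowA_zero h (by omega) (by omega)).2, sum_add_distrib, sum_range_cd_succ x le_rfl,
      sum_range_cd_succ v le_rfl, mul_comm (gam s), mul_right_comm, ← mul_assoc, ← ex_add]
    congr 3
    rw [← mul_add, ← Complex.ofReal_add]
    congr 2
    ring
  · intro j hj
    exact lowA_pos h (by omega) (by omega)
  · intro j hj
    rw [em_of_lt x (by omega)]
    exact add_pos_of_pos_of_nonneg (Real.exp_pos _) (em_nonneg _ _)
  · intro j hj
    rfl
  · intro j hj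
    exact log_em_add a x v (by omega) (by omega)

end chains

/-! ### Exchange relations for the kernels. -/

section exchange

variable {m : ℕ}

/-- Both sides are products of the same Bessel integrals with opposite index; the extra integral on
the left is the Gamma factor. -/
theorem int_w_wall_w_eq {a : ℝ} (α β : ℂ) {u z : Fin (m + 1) → ℝ} (h : 0 < coup a u z) :
    int volume (fun y : Fin (m + 1) → ℝ => w α u y * wall a y * w β z y)
      = gam (α + β) * ex (-(α + β) * Real.log (coup a u z))
        * int volume (fun v : Fin m → ℝ => w (-β) u v * wall a v * w (-α) z v) := by
  rw [int_lower a α β u z le_rfl le_rfl, int_lower a (-β) (-α) u z (by omega) (by omega),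
    prod_besselInt_of_eq _ h, show -(-β + -α) = α + β by ring]
  simp only [← mul_assoc]
  congr 1
  rw [mul_comm (ex _) (gam _), mul_assoc (gam _), mul_assoc (gam _), ← ex_add, ← ex_add]
  congr 2
  push_cast
  ring

theorem int_w_wall_w_lt {a : ℝ} (α β : ℂ) {z : Fin (m + 1) → ℝ} {u : Fin m → ℝ}
    (h : 0 < coup a z u) :
    int volume (fun v : Fin m → ℝ => w α z v * wall a v * w β u v)
      = ex (-(α + β) * Real.log (coup a z u))
        * int volume (fun v : Fin m → ℝ => w (-β) z v * wall a v * w (-α) u v) := by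
  rw [int_lower a α β z u (by omega) le_rfl, int_lower a (-β) (-α) z u (by omega) le_rfl,
    prod_besselInt_of_lt _ h, show -(-β + -α) = - -(α + β) by ring]
  simp only [← mul_assoc, ← ex_add]
  congr 2
  push_cast
  ring

theorem coup_zero_pos (x : Fin (m + 1) → ℝ) {p : ℕ} (v : Fin p → ℝ) : 0 < coup 0 x v := by
  rw [coup, em_of_lt x (by omega)]
  have := em_nonneg v 0
  have := Real.exp_pos (-cd x 0)
  linarith

theorem mul_rearrange {M : Type*} [CommMonoid M] {G E₁ E₂ E₃ E₄ J J' L K : M}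
    (h : E₁ * E₂ = E₃ * E₄) (h' : G * E₃ * J = L * J') :
    G * (E₁ * J * (E₂ * K)) = L * (E₄ * J' * K) := by
  rw [show G * (E₁ * J * (E₂ * K)) = E₁ * E₂ * (G * J * K) by ac_rfl, h,
    show E₃ * E₄ * (G * J * K) = G * E₃ * J * (E₄ * K) by ac_rfl, h']
  ac_rfl

theorem mul_rearrange' {M : Type*} [CommMonoid M] {G E₁ E₂ E₃ E₄ J J' L K : M}
    (h : E₁ * E₂ = E₃ * E₄) (h' : G * E₃ * J = L * J') :
    E₁ * J * (G * E₂ * K) = L * (E₄ * J' * K) := by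
  rw [← mul_rearrange h h']
  ac_rfl

theorem mul_rearrange'' {M : Type*} [CommMonoid M] {G E₁ E₂ E₃ E₄ K : M}
    (h : E₁ * E₂ * E₃ = E₄) : E₁ * (E₂ * K * (E₃ * G)) = G * (E₄ * K) := by
  rw [← h]
  ac_rfl

/-- The chain is inverted without a Gamma function, so the one required by `gam_mul_int` for the
boundary coordinate stays on the left. -/
theorem gam_mul_int_w_w {a : ℝ} (ha : 0 < a) (α β : ℂ) {k : ℝ → ℂ} (hk : Measurable k)
    (hk0 : ∀ x ≤ 0, k x = 0) (x : Fin (m + 1) → ℝ) (v : Fin m → ℝ) :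
    gam (-(α + β)) * int volume (fun z : Fin (m + 1) → ℝ => w α z x * of (k (gate a z)) * w β z v)
      = ex ((α + β) * Real.log a) * int volume (fun z : Fin (m + 1) → ℝ =>
        w (-β) z x * rl (-(α + β)) k (gate a z) * w (-α) z v) := by
  have hc := coup_zero_pos x v
  have hB : coup 0 x v = em x 0 + em v 0 := by simp [coup]
  have hT := gam_mul_int ha (hB ▸ hc) (-(α + β)) hk hk0
  rw [neg_neg] at hT
  rw [int_upper a α β x v (k := fun t => of (k t)) (by fun_prop),
    int_upper a (-β) (-α) x v (measurable_rl _ hk),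
    prod_besselInt_of_lt _ hc, show -β + -α = -(α + β) by ring]
  set J := int volume (fun t : ℝ => ex ((α + β) * t - ((em x 0 + em v 0) * Real.exp t : ℝ))
          * of (k (1 - a * Real.exp (-t))))
  set J' := int volume (fun V : ℝ => ex (-(α + β) * V - ((em x 0 + em v 0) * Real.exp V : ℝ))
          * rl (-(α + β)) k (1 - a * Real.exp (-V)))
  have e1 : ex (-α * (∑ j, x j : ℝ) - β * (∑ j, v j : ℝ))
        * ex ((α + β) * (Real.log (coup 0 x v) + ∑ j, x j + ∑ j, v j : ℝ))
      = ex ((α + β) * Real.log (em x 0 + em v 0))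
        * ex (- -β * (∑ j, x j : ℝ) - -α * (∑ j, v j : ℝ)) := by
    rw [← ex_add, ← ex_add, hB]
    congr 1; push_cast; ring
  exact mul_rearrange e1 hT

/-- The degenerate end of the chain supplies exactly the Gamma function that `gam_mul_int` consumes.
Hence one dimension is lost without a Gamma factor. -/
theorem int_w_w {a : ℝ} (ha : 0 < a) (α β : ℂ) {k : ℝ → ℂ} (hk : Measurable k)
    (hk0 : ∀ x ≤ 0, k x = 0) (x v : Fin m → ℝ) :
    int volume (fun z : Fin (m + 1) → ℝ => w α z x * of (k (gate a z)) * w β z v)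
      = ex ((α + β) * Real.log a) * int volume (fun z : Fin m → ℝ =>
        w (-β) z x * rl (-(α + β)) k (gate a z) * w (-α) z v) := by
  rw [int_upper a α β x v (k := fun t => of (k t)) (by fun_prop)]
  cases m with
  | zero =>
    have : IsProbabilityMeasure (volume : Measure (Fin 0 → ℝ)) :=
      ⟨by rw [volume_pi, Measure.pi_univ]; simp⟩
    rw [int_unique (volume : Measure (Fin 0 → ℝ))]
    -- Without coordinates in `x` and `v` the exponential growth term is absent and the boundary
    -- variable is 1, so `int_rl` applies with q = 1.
    have h := int_rl ha zero_lt_one le_rfl (-(α + β)) hk hk0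
    simp only [sub_self, zero_mul, zero_div, sub_zero, pwp_one, mul_one, neg_neg] at h
    have hg : ∀ z : Fin 0 → ℝ, gate a z = 1 := fun z => by simp [gate, em]
    have hw : ∀ (τ : ℂ) (z y : Fin 0 → ℝ), w τ z y = 1 := fun τ z y => by simp [w, wexp]
    rw [hg, hw, hw, one_mul, mul_one, ← h]
    simp [em, ex]
  | succ m =>
    have hc := coup_zero_pos x v
    have hB : coup 0 x v = em x 0 + em v 0 := by simp [coup]
    have hT := gam_mul_int ha (hB ▸ hc) (-(α + β)) hk hk0
    rw [neg_neg] at hT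
    have hp := prod_besselInt_of_eq (-(α + β)) hc
    rw [neg_neg] at hp
    rw [int_upper a (-β) (-α) x v (measurable_rl _ hk), hp, show -β + -α = -(α + β) by ring]
    set J := int volume (fun t : ℝ => ex ((α + β) * t - ((em x 0 + em v 0) * Real.exp t : ℝ))
          * of (k (1 - a * Real.exp (-t))))
    set J' := int volume (fun V : ℝ => ex (-(α + β) * V - ((em x 0 + em v 0) * Real.exp V : ℝ))
          * rl (-(α + β)) k (1 - a * Real.exp (-V)))
    have e1 : ex (-α * (∑ j, x j : ℝ) - β * (∑ j, v j : ℝ))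
          * ex ((α + β) * (Real.log (coup 0 x v) + ∑ j, x j + ∑ j, v j : ℝ))
        = ex ((α + β) * Real.log (em x 0 + em v 0))
          * ex (- -β * (∑ j, x j : ℝ) - -α * (∑ j, v j : ℝ)) := by
      rw [← ex_add, ← ex_add, hB]
      congr 1; push_cast; ring
    exact mul_rearrange' e1 hT

/-- Exchange of the GL Baxter and raising kernels: the Bessel chain inverts, and its last link is a
Gamma integral because neither `z` nor `y` reaches that far. -/
theorem int_w_mul_w (κ σ : ℂ) (z : Fin (m + 1) → ℝ) (y : Fin m → ℝ) :
    int volume (fun x : Fin (m + 1) → ℝ => w (-κ) z x * w (-σ) x y)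
      = gam (σ - κ) * int volume (fun x : Fin m → ℝ => w (-σ) z x * w (-κ) x y) := by
  have hA : ∀ j < m + 1, 0 < ep z j + eps y j := by
    intro j hj
    rw [ep_of_lt z hj]
    refine add_pos_of_pos_of_nonneg (Real.exp_pos _) ?_
    cases j with
    | zero => exact le_rfl
    | succ j => exact ep_nonneg _ _
  have hA0 : Real.log (ep z 0 + eps y 0) = cd z 0 := by
    rw [ep_of_lt z (by omega), eps, add_zero, Real.log_exp]
  have hB : ∀ j < m, Real.log (em z (j + 1) + em y j)
      = Real.log (ep z (j + 1) + eps y (j + 1)) - (cd z (j + 1) + cd y j) := by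
    intro j hj
    rw [eps, em_of_lt z (by omega), em_of_lt y hj, ep_of_lt z (by omega), ep_of_lt y hj,
      log_exp_neg_add]
  rw [int_middle _ _ z y le_rfl, int_middle _ _ z y (by omega), prod_range_succ,
    prod_besselInt_chain _ m (L := fun j => Real.log (ep z j + eps y j))
    (r := fun j => cd z (j + 1) + cd y j) (fun j hj => hA j (by omega))
    (fun j hj => by
      rw [em_of_lt z (by omega), em_of_lt y hj]
      positivity) (fun j hj => rfl) hB,
    em_of_le z le_rfl, em_of_le y le_rfl, add_zero, show -σ - -κ = -(σ - κ) by ring,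
    besselInt_zero_right _ (hA m (by omega)), hA0, sum_add_distrib, sum_range_cd_succ z le_rfl,
    sum_range_cd y le_rfl, show - -(σ - κ) = -κ - -σ by ring]
  refine mul_rearrange'' ?_
  rw [← ex_add, ← ex_add]
  congr 1
  push_cast
  ring

end exchange

end Toda

end

/-! ### Dominated wave functions, Baxter operators and GL diagonality. -/

noncomputable section

namespace Toda

open scoped ENNReal
open DomC Finset

namespace DomC

variable {A B C : Type*} [MeasurableSpace A] [MeasurableSpace B] [MeasurableSpace C]
  {μ : Measure A} {ν : Measure B} {η : Measure C}

theorem int_mul_int {F : A → DomC} {G : B → DomC} (hF : Measurable F) (hG : Measurable G) :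
    int μ F * int ν G = int μ fun a => int ν fun b => F a * G b := by
  rw [← int_mul_const _ _ hF]
  exact int_congr fun a => (int_const_mul _ _ hG).symm

theorem int_rotate [SFinite μ] [SFinite ν] [SFinite η] {F : A → B → C → DomC}
    (hF : Measurable fun p : A × B × C => F p.1 p.2.1 p.2.2) :
    (int μ fun a => int ν fun b => int η fun c => F a b c)
      = int ν fun b => int η fun c => int μ fun a => F a b c := by
  rw [int_swap (measurable_int (F := fun (p : A × B) c => F p.1 p.2 c)
    (hF.comp (by fun_prop : Measurable fun p : (A × B) × C => (p.1.1, p.1.2, p.2))))]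
  exact int_congr fun b => int_swap
    (hF.comp (by fun_prop : Measurable fun p : A × C => (p.1, b, p.2)))

theorem int_const_mul₂ [SFinite ν] (c : DomC) {F : A → B → DomC}
    (hF : Measurable fun p : A × B => F p.1 p.2) :
    (int μ fun a => int ν fun b => c * F a b) = c * int μ fun a => int ν fun b => F a b := by
  rw [← int_const_mul _ _ (measurable_int hF)]
  exact int_congr fun a => int_const_mul _ _ (hF.comp (by fun_prop : Measurable fun b => (a, b)))

end DomC

/-- The wave function of the `GL` Toda chain with parameters `-σ`, as a dominated number. -/
def phi : (n : ℕ) → (Fin n → ℂ) → (Fin n → ℝ) → DomC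
  | 0, _ => fun _ => 1
  | m + 1, σ => fun x => int volume fun y : Fin m → ℝ =>
      w (-σ (Fin.last m)) x y * phi m (fun j => σ j.castSucc) y

/-- The regularized kernel of the `BC` raising operator. -/
def raiseKer {m : ℕ} (a : ℝ) (g κ : ℂ) (x : Fin (m + 1) → ℝ) (y : Fin m → ℝ) : DomC :=
  int volume fun z : Fin (m + 1) → ℝ =>
    w (-κ) z x * of (pwp (gate a z) (g - κ - 1)) * (w (-κ) z y * wall a y)

/-- The regularized wave function of the `BC` Toda chain. -/
def psi (a : ℝ) (g : ℂ) : (n : ℕ) → (Fin n → ℂ) → (Fin n → ℝ) → DomC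
  | 0, _ => fun _ => 1
  | m + 1, κ => fun x => int volume fun y : Fin m → ℝ =>
      raiseKer a g (κ (Fin.last m)) x y * psi a g m (fun j => κ j.castSucc) y

/-- The kernel of the Baxter operator of the `BC` Toda chain. -/
def baxter {n : ℕ} (a : ℝ) (g σ : ℂ) (x y : Fin n → ℝ) : DomC :=
  int volume fun u : Fin n → ℝ =>
    w σ u x * of (pwp (gate a u) (g + σ - 1)) * (w σ u y * wall a y)

section measurability

variable {A : Type*} [MeasurableSpace A] {m n : ℕ}

theorem measurable_phi (n : ℕ) (σ : Fin n → ℂ) : Measurable (phi n σ) := by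
  induction n with
  | zero => exact measurable_const
  | succ m ih =>
    have := ih fun j => σ j.castSucc
    exact measurable_int (F := fun x y => w _ x y * phi m _ y) (by fun_prop)

@[fun_prop] theorem _root_.Measurable.todaPhi (σ : Fin n → ℂ) {f : A → Fin n → ℝ}
    (hf : Measurable f) : Measurable fun x => phi n σ (f x) := (measurable_phi n σ).comp hf

@[fun_prop] theorem _root_.Measurable.todaRaiseKer (a : ℝ) (g κ : ℂ) {f : A → Fin (m + 1) → ℝ}
    {h : A → Fin m → ℝ} (hf : Measurable f) (hh : Measurable h) :
    Measurable fun x => raiseKer a g κ (f x) (h x) :=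
  measurable_int (F := fun x z =>
    w (-κ) z (f x) * of (pwp (gate a z) (g - κ - 1)) * (w (-κ) z (h x) * wall a (h x)))
    (by fun_prop)

@[fun_prop] theorem _root_.Measurable.todaBaxter (a : ℝ) (g σ : ℂ) {f : A → Fin n → ℝ}
    {h : A → Fin n → ℝ} (hf : Measurable f) (hh : Measurable h) :
    Measurable fun x => baxter a g σ (f x) (h x) :=
  measurable_int (F := fun x u =>
    w σ u (f x) * of (pwp (gate a u) (g + σ - 1)) * (w σ u (h x) * wall a (h x)))
    (by fun_prop)

theorem measurable_psi (a : ℝ) (g : ℂ) (n : ℕ) (κ : Fin n → ℂ) : Measurable (psi a g n κ) := by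
  induction n with
  | zero => exact measurable_const
  | succ m ih =>
    have := ih fun j => κ j.castSucc
    exact measurable_int (F := fun x y => raiseKer a g _ x y * psi a g m _ y) (by fun_prop)

@[fun_prop] theorem _root_.Measurable.todaPsi (a : ℝ) (g : ℂ) (κ : Fin n → ℂ)
    {f : A → Fin n → ℝ} (hf : Measurable f) : Measurable fun x => psi a g n κ (f x) :=
  (measurable_psi a g n κ).comp hf

end measurability

instance : IsProbabilityMeasure (volume : Measure (Fin 0 → ℝ)) :=
  ⟨by rw [volume_pi, Measure.pi_univ]; simp⟩

theorem w_zero (τ : ℂ) (z y : Fin 0 → ℝ) : w τ z y = 1 := by simp [w, wexp]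

/-- The wave functions of the `GL` chain are eigenfunctions of the Baxter operators. -/
theorem int_w_phi (κ : ℂ) {n : ℕ} (σ : Fin n → ℂ) (z : Fin n → ℝ) :
    int volume (fun x : Fin n → ℝ => w (-κ) z x * phi n σ x)
      = (∏ j, gam (σ j - κ)) * phi n σ z := by
  induction n with
  | zero =>
    rw [int_unique (volume : Measure (Fin 0 → ℝ)), w_zero]
    simp [phi]
  | succ m ih =>
    set s := σ (Fin.last m)
    set σ' : Fin m → ℂ := fun j => σ j.castSucc
    calc int volume (fun x : Fin (m + 1) → ℝ => w (-κ) z x * phi (m + 1) σ x)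
        = int volume fun x : Fin (m + 1) → ℝ => int volume fun y : Fin m → ℝ =>
            w (-κ) z x * (w (-s) x y * phi m σ' y) :=
          int_congr fun x => (int_const_mul _ _ (by fun_prop)).symm
      _ = int volume fun y : Fin m → ℝ => int volume fun x : Fin (m + 1) → ℝ =>
            w (-κ) z x * (w (-s) x y * phi m σ' y) := int_swap (by fun_prop)
      _ = int volume fun y : Fin m → ℝ => int volume fun x : Fin m → ℝ =>
            gam (s - κ) * (w (-s) z x * (w (-κ) x y * phi m σ' y)) := by
          -- The Baxter kernel is moved past the raising kernel and then acts on m variables, where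
          -- the induction hypothesis applies.
          refine int_congr fun y => ?_
          simp only [← mul_assoc]
          rw [int_mul_const _ _ (by fun_prop), int_w_mul_w, int_mul_const _ _ (by fun_prop)]
          simp only [mul_assoc]
          rw [int_const_mul _ _ (by fun_prop)]
          simp only [mul_assoc]
      _ = gam (s - κ) * int volume fun y : Fin m → ℝ => int volume fun x : Fin m → ℝ =>
            w (-s) z x * (w (-κ) x y * phi m σ' y) := int_const_mul₂ _ (by fun_prop)
      _ = gam (s - κ) * int volume fun x : Fin m → ℝ => int volume fun y : Fin m → ℝ =>
            w (-s) z x * (w (-κ) x y * phi m σ' y) := by rw [int_swap (by fun_prop)]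
      _ = gam (s - κ) * int volume fun x : Fin m → ℝ =>
            (∏ j, gam (σ' j - κ)) * (w (-s) z x * phi m σ' x) := by
          congr 1
          refine int_congr fun x => ?_
          rw [int_const_mul _ _ (by fun_prop), ih, mul_left_comm]
      _ = _ := by
          rw [int_const_mul _ _ (by fun_prop), Fin.prod_univ_castSucc, ← mul_assoc,
            mul_comm (gam _)]
          rfl

/-! ### Reflection at the boundary and BC diagonality. -/

section reflection

/-- The weight of two boundary variables. -/
def reflKer (g σ κ : ℂ) (p x : ℝ) : ℂ :=
  pwp p (g + σ - 1) * pwp x (g - κ - 1) * pwp (1 - p * x) (-(σ - κ))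

@[fun_prop] theorem _root_.Measurable.todaReflKer {A : Type*} [MeasurableSpace A] (g σ κ : ℂ)
    {f h : A → ℝ} (hf : Measurable f) (hh : Measurable h) :
    Measurable fun a => reflKer g σ κ (f a) (h a) := by
  unfold reflKer
  fun_prop

theorem reflKer_of_nonpos (g σ κ : ℂ) (p : ℝ) : ∀ x ≤ 0, reflKer g σ κ p x = 0 := fun x hx => by
  rw [reflKer, pwp_of_nonpos hx]; simp

@[fun_prop] theorem _root_.Measurable.todaRl {A : Type*} [MeasurableSpace A] (c g σ κ : ℂ)
    {f h : A → ℝ} (hf : Measurable f) (hh : Measurable h) :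
    Measurable fun a => rl c (reflKer g σ κ (f a)) (h a) :=
  measurable_int (F := fun a τ => of (pwp (h a) c * pwp (1 - τ) (c - 1)
    * reflKer g σ κ (f a) (h a * τ))) (by fun_prop)

/-- The reflection equation: the transformed boundary weight is symmetric. -/
theorem rl_reflKer_symm (g σ κ : ℂ) (p q : ℝ) :
    rl (σ + κ) (reflKer g σ κ p) q = rl (σ + κ) (reflKer g σ κ q) p := by
  refine int_congr fun τ => ?_
  congr 1
  by_cases hp : 0 < p
  · by_cases hq : 0 < q
    -- With g + σ - 1 = (σ + κ) + (g - κ - 1), the integrand depends on p and q only through pq.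
    · rw [reflKer, reflKer, pwp_mul hp, pwp_mul hq,
        show g + σ - 1 = (σ + κ) + (g - κ - 1) by ring, pwp_add p (σ + κ), pwp_add q (σ + κ),
        show p * (q * τ) = q * (p * τ) by ring]
      ring
    · simp [reflKer, pwp_of_nonpos (not_lt.1 hq)]
  · simp [reflKer, pwp_of_nonpos (not_lt.1 hp)]

theorem gate_lt_one {m : ℕ} {a : ℝ} (ha : 0 < a) (z : Fin (m + 1) → ℝ) : gate a z < 1 := by
  rw [gate, em_of_lt z (by omega)]
  have := mul_pos ha (Real.exp_pos (-cd z 0))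
  linarith

theorem gate_le_one {m : ℕ} {a : ℝ} (ha : 0 < a) (z : Fin m → ℝ) : gate a z ≤ 1 := by
  rw [gate]
  have := mul_nonneg ha.le (em_nonneg z 0)
  linarith

/-- If gate(u) > 0 then gate(u) gate(z) ≤ gate(u) < 1, so the coupling is positive and its power is
defined. -/
theorem ex_log_coup {m p : ℕ} {a : ℝ} (ha : 0 < a) (σ κ : ℂ) (u : Fin (m + 1) → ℝ)
    (z : Fin p → ℝ) (hu : 0 < gate a u) :
    0 < coup a u z ∧ ex (-(σ - κ) * Real.log (coup a u z))
      = ex ((σ - κ) * Real.log a) * of (pwp (1 - gate a u * gate a z) (-(σ - κ))) := by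
  have h1 : 0 < 1 - gate a u * gate a z := by
    have := mul_le_mul_of_nonneg_left (gate_le_one ha z) hu.le
    have := gate_lt_one ha u
    linarith
  rw [coup_eq ha.ne']
  refine ⟨div_pos h1 ha, ?_⟩
  rw [pwp_of_pos h1, Real.log_div h1.ne' ha.ne', ← ex, ← ex_add]
  congr 1
  push_cast
  ring

variable {m : ℕ}

/-- The exchange relation needs a positive coupling; where a gate is not positive, the boundary
powers annihilate both sides. -/
theorem pwp_mul_pwp_mul_int_eq {a : ℝ} (ha : 0 < a) (g σ κ : ℂ) (u z : Fin (m + 1) → ℝ) :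
    of (pwp (gate a u) (g + σ - 1)) * of (pwp (gate a z) (g - κ - 1)) *
        int volume (fun y : Fin (m + 1) → ℝ => w σ u y * wall a y * w (-κ) z y)
      = gam (σ - κ) * ex ((σ - κ) * Real.log a) * (of (reflKer g σ κ (gate a u) (gate a z))
        * int volume fun v : Fin m → ℝ => w κ u v * wall a v * w (-σ) z v) := by
  by_cases hu : 0 < gate a u
  · by_cases hz : 0 < gate a z
    · obtain ⟨h1, h2⟩ := ex_log_coup ha σ κ u z hu
      rw [int_w_wall_w_eq σ (-κ) h1, ← sub_eq_add_neg, h2, reflKer, map_mul, map_mul, neg_neg]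
      ac_rfl
    · rw [reflKer, pwp_of_nonpos (not_lt.1 hz), mul_zero, zero_mul, of_zero_mul, mul_comm (of _),
        of_zero_mul, of_zero_mul, mul_comm, of_zero_mul]
  · rw [reflKer, pwp_of_nonpos (not_lt.1 hu), zero_mul, zero_mul, of_zero_mul, of_zero_mul,
      of_zero_mul, mul_comm, of_zero_mul]

theorem pwp_mul_pwp_mul_int_lt {a : ℝ} (ha : 0 < a) (g σ κ : ℂ) (u : Fin (m + 1) → ℝ)
    (z : Fin m → ℝ) :
    of (pwp (gate a z) (g + σ - 1)) * of (pwp (gate a u) (g - κ - 1)) *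
        int volume (fun v : Fin m → ℝ => w (-κ) u v * wall a v * w σ z v)
      = ex ((σ - κ) * Real.log a) * (of (reflKer g σ κ (gate a z) (gate a u))
        * int volume fun v : Fin m → ℝ => w (-σ) u v * wall a v * w κ z v) := by
  by_cases hz : 0 < gate a z
  · by_cases hu : 0 < gate a u
    · obtain ⟨h1, h2⟩ := ex_log_coup ha σ κ u z hu
      rw [int_w_wall_w_lt (-κ) σ h1, neg_add_eq_sub, h2, reflKer, map_mul, map_mul, neg_neg,
        mul_comm (gate a z)]
      ac_rfl
    · rw [reflKer, pwp_of_nonpos (not_lt.1 hu), mul_zero, zero_mul, of_zero_mul, mul_comm (of _),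
        of_zero_mul, of_zero_mul, mul_comm, of_zero_mul]
  · rw [reflKer, pwp_of_nonpos (not_lt.1 hz), zero_mul, zero_mul, of_zero_mul, of_zero_mul,
      of_zero_mul, mul_comm, of_zero_mul]

/-- The exchange relation of the Baxter operator and the raising operator of the `BC` chain. -/
theorem int_baxter_raiseKer {a : ℝ} (ha : 0 < a) (g σ κ : ℂ) (x : Fin (m + 1) → ℝ)
    (y₀ : Fin m → ℝ) :
    int volume (fun y : Fin (m + 1) → ℝ => baxter a g σ x y * raiseKer a g κ y y₀)
      = gam (σ - κ) * gam (σ + κ) *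
        int volume fun v : Fin m → ℝ => raiseKer a g κ x v * baxter a g σ v y₀ := by
  set C₁ := ex ((σ - κ) * Real.log a) with hC₁
  set C₂ := ex (-(σ + κ) * Real.log a) with hC₂
  have hsum : -(-σ + -κ) = σ + κ := by ring
  have hsum' : -σ + -κ = -(σ + κ) := by ring
  -- The integral over y drops to m variables and gives Γ(σ - κ) and the weight `reflKer`; the
  -- integral over z then drops to m variables by `int_w_w`.
  have hL : int volume (fun y : Fin (m + 1) → ℝ => baxter a g σ x y * raiseKer a g κ y y₀)
      = gam (σ - κ) * C₁ * C₂ * int volume fun u : Fin (m + 1) → ℝ =>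
        int volume fun v : Fin m → ℝ => int volume fun z : Fin m → ℝ =>
        w σ u x * (w κ u v * wall a v) * wall a y₀ * (w κ z v
          * rl (σ + κ) (reflKer g σ κ (gate a u)) (gate a z) * w σ z y₀) := by
    calc _ = int volume fun y : Fin (m + 1) → ℝ => int volume fun u : Fin (m + 1) → ℝ =>
            int volume fun z : Fin (m + 1) → ℝ =>
            w σ u x * of (pwp (gate a u) (g + σ - 1)) * (w σ u y * wall a y) *
            (w (-κ) z y * of (pwp (gate a z) (g - κ - 1)) * (w (-κ) z y₀ * wall a y₀)) :=
          int_congr fun y => int_mul_int (by fun_prop) (by fun_prop)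
      _ = int volume fun u : Fin (m + 1) → ℝ => int volume fun z : Fin (m + 1) → ℝ =>
            int volume fun y : Fin (m + 1) → ℝ =>
            w σ u x * of (pwp (gate a u) (g + σ - 1)) * (w σ u y * wall a y) *
            (w (-κ) z y * of (pwp (gate a z) (g - κ - 1)) * (w (-κ) z y₀ * wall a y₀)) :=
          int_rotate (by fun_prop)
      _ = int volume fun u : Fin (m + 1) → ℝ => int volume fun z : Fin (m + 1) → ℝ =>
            gam (σ - κ) * C₁ * int volume fun v : Fin m → ℝ =>
            w σ u x * (w κ u v * wall a v) * wall a y₀ *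
            (w (-σ) z v * of (reflKer g σ κ (gate a u) (gate a z)) * w (-κ) z y₀) := by
          refine int_congr fun u => int_congr fun z => ?_
          rw [int_congr (G := fun y => w σ u x * (w (-κ) z y₀ * wall a y₀)
              * (of (pwp (gate a u) (g + σ - 1)) * of (pwp (gate a z) (g - κ - 1)))
              * (w σ u y * wall a y * w (-κ) z y)) fun y => by ac_rfl,
            int_const_mul _ _ (by fun_prop), mul_assoc, pwp_mul_pwp_mul_int_eq ha, ← hC₁,
            mul_left_comm]
          congr 1
          rw [← mul_assoc, ← int_const_mul _ _ (by fun_prop)]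
          exact int_congr fun v => by ac_rfl
      _ = gam (σ - κ) * C₁ * int volume fun u : Fin (m + 1) → ℝ =>
            int volume fun z : Fin (m + 1) → ℝ => int volume fun v : Fin m → ℝ =>
            w σ u x * (w κ u v * wall a v) * wall a y₀ *
            (w (-σ) z v * of (reflKer g σ κ (gate a u) (gate a z)) * w (-κ) z y₀) :=
          int_const_mul₂ _ (by fun_prop)
      _ = gam (σ - κ) * C₁ * int volume fun u : Fin (m + 1) → ℝ =>
            int volume fun v : Fin m → ℝ => int volume fun z : Fin (m + 1) → ℝ =>
            w σ u x * (w κ u v * wall a v) * wall a y₀ *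
            (w (-σ) z v * of (reflKer g σ κ (gate a u) (gate a z)) * w (-κ) z y₀) := by
          congr 1
          exact int_congr fun u => int_swap (by fun_prop)
      _ = gam (σ - κ) * C₁ * int volume fun u : Fin (m + 1) → ℝ =>
            int volume fun v : Fin m → ℝ => C₂ * int volume fun z : Fin m → ℝ =>
            w σ u x * (w κ u v * wall a v) * wall a y₀ * (w κ z v
              * rl (σ + κ) (reflKer g σ κ (gate a u)) (gate a z) * w σ z y₀) := by
          congr 1
          refine int_congr fun u => int_congr fun v => ?_
          rw [int_const_mul _ _ (by fun_prop), int_const_mul _ _ (by fun_prop),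
            int_w_w ha (-σ) (-κ) (by fun_prop) (reflKer_of_nonpos g σ κ _), hsum, neg_neg, neg_neg,
            hsum', mul_left_comm]
      _ = _ := by
          rw [int_const_mul₂ _ (by fun_prop), mul_assoc (gam _ * C₁)]
  -- The integral over v is exchanged at fixed length, then the one over u with the help of Γ(σ +
  -- κ). The fractional integral now acts on the gate of `u`, and `rl_reflKer_symm` transfers it to
  -- that of `z`, giving the integrand of the left side.
  have hR : gam (σ + κ) * int volume (fun v : Fin m → ℝ => raiseKer a g κ x v * baxter a g σ v y₀)
      = C₁ * C₂ * int volume fun v : Fin m → ℝ => int volume fun z : Fin m → ℝ =>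
        int volume fun u : Fin (m + 1) → ℝ =>
        w σ u x * (w κ u v * wall a v) * wall a y₀ * (w κ z v
          * rl (σ + κ) (reflKer g σ κ (gate a u)) (gate a z) * w σ z y₀) := by
    calc _ = gam (σ + κ) * int volume fun v : Fin m → ℝ => int volume fun u : Fin (m + 1) → ℝ =>
            int volume fun z : Fin m → ℝ =>
            w (-κ) u x * of (pwp (gate a u) (g - κ - 1)) * (w (-κ) u v * wall a v) *
            (w σ z v * of (pwp (gate a z) (g + σ - 1)) * (w σ z y₀ * wall a y₀)) := by
          congr 1
          exact int_congr fun y => int_mul_int (by fun_prop) (by fun_prop)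
      _ = gam (σ + κ) * int volume fun u : Fin (m + 1) → ℝ => int volume fun z : Fin m → ℝ =>
            int volume fun v : Fin m → ℝ =>
            w (-κ) u x * of (pwp (gate a u) (g - κ - 1)) * (w (-κ) u v * wall a v) *
            (w σ z v * of (pwp (gate a z) (g + σ - 1)) * (w σ z y₀ * wall a y₀)) := by
          rw [int_rotate (by fun_prop)]
      _ = gam (σ + κ) * int volume fun u : Fin (m + 1) → ℝ => int volume fun z : Fin m → ℝ =>
            C₁ * int volume fun v : Fin m → ℝ =>
            wall a v * w κ z v * w σ z y₀ * wall a y₀ *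
            (w (-κ) u x * of (reflKer g σ κ (gate a z) (gate a u)) * w (-σ) u v) := by
          congr 1
          refine int_congr fun u => int_congr fun z => ?_
          rw [int_congr (G := fun v => w (-κ) u x * (w σ z y₀ * wall a y₀)
              * (of (pwp (gate a z) (g + σ - 1)) * of (pwp (gate a u) (g - κ - 1)))
              * (w (-κ) u v * wall a v * w σ z v)) fun y => by ac_rfl,
            int_const_mul _ _ (by fun_prop), mul_assoc, pwp_mul_pwp_mul_int_lt ha, ← hC₁,
            mul_left_comm]
          congr 1
          rw [← mul_assoc, ← int_const_mul _ _ (by fun_prop)]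
          exact int_congr fun v => by ac_rfl
      _ = gam (σ + κ) * (C₁ * int volume fun v : Fin m → ℝ => int volume fun z : Fin m → ℝ =>
            int volume fun u : Fin (m + 1) → ℝ =>
            wall a v * w κ z v * w σ z y₀ * wall a y₀ *
            (w (-κ) u x * of (reflKer g σ κ (gate a z) (gate a u)) * w (-σ) u v)) := by
          rw [int_const_mul₂ _ (by fun_prop), int_rotate (by fun_prop), int_swap (by fun_prop)]
      _ = C₁ * int volume fun v : Fin m → ℝ => int volume fun z : Fin m → ℝ =>
            gam (σ + κ) * int volume fun u : Fin (m + 1) → ℝ =>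
            wall a v * w κ z v * w σ z y₀ * wall a y₀ *
            (w (-κ) u x * of (reflKer g σ κ (gate a z) (gate a u)) * w (-σ) u v) := by
          rw [int_const_mul₂ _ (by fun_prop), mul_left_comm]
      _ = C₁ * int volume fun v : Fin m → ℝ => int volume fun z : Fin m → ℝ =>
            C₂ * int volume fun u : Fin (m + 1) → ℝ =>
            w σ u x * (w κ u v * wall a v) * wall a y₀ * (w κ z v
              * rl (σ + κ) (reflKer g σ κ (gate a u)) (gate a z) * w σ z y₀) := by
          congr 1
          refine int_congr fun v => int_congr fun z => ?_
          have h := gam_mul_int_w_w ha (-κ) (-σ) (k := reflKer g σ κ (gate a z)) (by fun_prop)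
            (reflKer_of_nonpos g σ κ _) x v
          rw [show -(-κ + -σ) = σ + κ by ring, show -κ + -σ = -(σ + κ) by ring, neg_neg,
            neg_neg] at h
          rw [int_const_mul _ _ (by fun_prop), mul_left_comm, h, mul_left_comm]
          congr 1
          rw [← int_const_mul _ _ (by fun_prop)]
          refine int_congr fun u => ?_
          rw [rl_reflKer_symm]
          ac_rfl
      _ = _ := by
          rw [int_const_mul₂ _ (by fun_prop), mul_assoc C₁]
  rw [hL, mul_assoc (gam (σ - κ)) (gam (σ + κ)), hR, int_rotate (by fun_prop)]
  simp only [mul_assoc]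

/-- The wave functions of the `BC` chain are eigenfunctions of the Baxter operators. -/
theorem int_baxter_psi {a : ℝ} (ha : 0 < a) (g σ : ℂ) {n : ℕ} (κ : Fin n → ℂ) (x : Fin n → ℝ) :
    int volume (fun y : Fin n → ℝ => baxter a g σ x y * psi a g n κ y)
      = (∏ k, gam (σ - κ k) * gam (σ + κ k)) * psi a g n κ x := by
  induction n with
  | zero =>
    rw [int_unique (volume : Measure (Fin 0 → ℝ)), baxter, int_unique (volume : Measure (Fin 0 → ℝ))]
    simp [psi, w_zero, gate, wall, em]
  | succ m ih =>
    set s := κ (Fin.last m)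
    set κ' : Fin m → ℂ := fun j => κ j.castSucc
    calc int volume (fun y : Fin (m + 1) → ℝ => baxter a g σ x y * psi a g (m + 1) κ y)
        = int volume fun y : Fin (m + 1) → ℝ => int volume fun y₀ : Fin m → ℝ =>
            baxter a g σ x y * (raiseKer a g s y y₀ * psi a g m κ' y₀) :=
          int_congr fun x => (int_const_mul _ _ (by fun_prop)).symm
      _ = int volume fun y₀ : Fin m → ℝ => int volume fun y : Fin (m + 1) → ℝ =>
            baxter a g σ x y * (raiseKer a g s y y₀ * psi a g m κ' y₀) := int_swap (by fun_prop)
      _ = int volume fun y₀ : Fin m → ℝ => int volume fun v : Fin m → ℝ =>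
            gam (σ - s) * gam (σ + s)
              * (raiseKer a g s x v * (baxter a g σ v y₀ * psi a g m κ' y₀)) := by
          refine int_congr fun y₀ => ?_
          simp only [← mul_assoc]
          rw [int_mul_const _ _ (by fun_prop), int_baxter_raiseKer ha,
            int_mul_const _ _ (by fun_prop)]
          simp only [mul_assoc]
          rw [int_const_mul _ _ (by fun_prop), int_const_mul _ _ (by fun_prop)]
          simp only [mul_assoc]
      _ = gam (σ - s) * gam (σ + s) * int volume fun y₀ : Fin m → ℝ =>
            int volume fun v : Fin m → ℝ =>
            raiseKer a g s x v * (baxter a g σ v y₀ * psi a g m κ' y₀) :=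
          int_const_mul₂ _ (by fun_prop)
      _ = gam (σ - s) * gam (σ + s) * int volume fun v : Fin m → ℝ =>
            int volume fun y₀ : Fin m → ℝ =>
            raiseKer a g s x v * (baxter a g σ v y₀ * psi a g m κ' y₀) := by
          rw [int_swap (by fun_prop)]
      _ = gam (σ - s) * gam (σ + s) * int volume fun v : Fin m → ℝ =>
            (∏ k, gam (σ - κ' k) * gam (σ + κ' k)) * (raiseKer a g s x v * psi a g m κ' v) := by
          congr 1
          refine int_congr fun v => ?_
          rw [int_const_mul _ _ (by fun_prop), ih, mul_left_comm]
      _ = _ := by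
          rw [int_const_mul _ _ (by fun_prop), Fin.prod_univ_castSucc, ← mul_assoc,
            mul_comm (gam _ * _)]
          rfl

/-! ### Recursion for the scalar product. -/

/-- The recursion of the scalar products of the wave functions of the two chains. -/
theorem int_phi_psi_succ {a : ℝ} (ha : 0 < a) (g : ℂ) (σ κ : Fin (m + 1) → ℂ) :
    (∏ j : Fin m, gam (σ j.castSucc + σ (Fin.last m))) *
        int volume (fun x : Fin (m + 1) → ℝ => phi (m + 1) σ x * psi a g (m + 1) κ x)
      = (∏ j, gam (σ j - κ (Fin.last m))) * (∏ j : Fin m, gam (σ j.castSucc + κ (Fin.last m)))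
        * ex (-(σ (Fin.last m) + κ (Fin.last m)) * Real.log a)
        * bet (σ (Fin.last m) + κ (Fin.last m)) (g - κ (Fin.last m))
        * (∏ k : Fin m, gam (σ (Fin.last m) - κ k.castSucc) * gam (σ (Fin.last m) + κ k.castSucc))
        * int volume (fun x : Fin m → ℝ => phi m (fun j => σ j.castSucc) x
          * psi a g m (fun j => κ j.castSucc) x) := by
  set s := σ (Fin.last m) with hs
  set t := κ (Fin.last m) with ht
  set σ' : Fin m → ℂ := fun j => σ j.castSucc with hσ'
  set κ' : Fin m → ℂ := fun j => κ j.castSucc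
  set C := ex (-(s + t) * Real.log a) with hC
  set b := bet (s + t) (g - t) with hb
  -- The x-dependence of the raising kernel is a GL Baxter kernel with parameter t, of which `phi`
  -- is an eigenfunction.
  have h1 : int volume (fun x : Fin (m + 1) → ℝ => phi (m + 1) σ x * psi a g (m + 1) κ x)
      = (∏ j, gam (σ j - t)) * int volume fun y : Fin m → ℝ => int volume fun z : Fin (m + 1) → ℝ =>
        phi (m + 1) σ z * (of (pwp (gate a z) (g - t - 1)) * (w (-t) z y * wall a y)
          * psi a g m κ' y) := by
    calc _ = int volume fun x : Fin (m + 1) → ℝ => int volume fun y : Fin m → ℝ =>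
            int volume fun z : Fin (m + 1) → ℝ =>
            w (-t) z x * phi (m + 1) σ x * (of (pwp (gate a z) (g - t - 1))
              * (w (-t) z y * wall a y) * psi a g m κ' y) := by
          refine int_congr fun x => ?_
          rw [psi, ← int_const_mul _ _ (by fun_prop)]
          refine int_congr fun y => ?_
          rw [raiseKer, ← int_mul_const _ _ (by fun_prop), ← int_const_mul _ _ (by fun_prop)]
          refine int_congr fun z => ?_
          ac_rfl
      _ = int volume fun y : Fin m → ℝ => int volume fun z : Fin (m + 1) → ℝ =>
            int volume fun x : Fin (m + 1) → ℝ =>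
            w (-t) z x * phi (m + 1) σ x * (of (pwp (gate a z) (g - t - 1))
              * (w (-t) z y * wall a y) * psi a g m κ' y) := int_rotate (by fun_prop)
      _ = _ := by
          rw [← int_const_mul₂ _ (by fun_prop)]
          refine int_congr fun y => int_congr fun z => ?_
          rw [int_mul_const _ _ (by fun_prop), int_w_phi, mul_assoc]
  -- Unfolding `phi` once, `int_w_w` lowers z to m variables; the fractional integral of the
  -- boundary power yields the Beta factor, and the kernel left over is a GL Baxter kernel with
  -- parameter -t.
  have h2 : (int volume fun y : Fin m → ℝ => int volume fun z : Fin (m + 1) → ℝ =>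
        phi (m + 1) σ z * (of (pwp (gate a z) (g - t - 1)) * (w (-t) z y * wall a y)
          * psi a g m κ' y))
      = C * b * (∏ j, gam (σ' j + t)) * int volume fun y : Fin m → ℝ =>
        int volume fun u : Fin m → ℝ =>
        phi m σ' u * (of (pwp (gate a u) (g + s - 1)) * (w s u y * wall a y)
          * psi a g m κ' y) := by
    rw [← int_const_mul₂ _ (by fun_prop)]
    refine int_congr fun y => ?_
    calc _ = int volume fun z : Fin (m + 1) → ℝ => int volume fun v : Fin m → ℝ =>
            phi m σ' v * (wall a y * psi a g m κ' y)
              * (w (-s) z v * of (pwp (gate a z) (g - t - 1)) * w (-t) z y) := by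
          refine int_congr fun z => ?_
          rw [phi, ← int_mul_const _ _ (by fun_prop), ← hs, ← hσ']
          exact int_congr fun v => by ac_rfl
      _ = int volume fun v : Fin m → ℝ => int volume fun z : Fin (m + 1) → ℝ =>
            phi m σ' v * (wall a y * psi a g m κ' y)
              * (w (-s) z v * of (pwp (gate a z) (g - t - 1)) * w (-t) z y) :=
          int_swap (by fun_prop)
      _ = int volume fun v : Fin m → ℝ => int volume fun u : Fin m → ℝ => C * b *
            (w t u v * phi m σ' v * (of (pwp (gate a u) (g + s - 1)) * (w s u y * wall a y)
              * psi a g m κ' y)) := by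
          refine int_congr fun v => ?_
          rw [int_const_mul _ _ (by fun_prop), int_w_w ha (-s) (-t) (k := fun q => pwp q (g - t - 1))
            (by fun_prop) fun q hq => pwp_of_nonpos hq _, neg_neg, neg_neg,
            show -(-s + -t) = s + t by ring, show -s + -t = -(s + t) by ring, mul_left_comm,
            ← int_const_mul _ _ (by fun_prop), ← int_const_mul _ _ (by fun_prop)]
          refine int_congr fun u => ?_
          rw [rl_pwp, show s + t + (g - t) - 1 = g + s - 1 by ring, ← hC, ← hb]
          ac_rfl
      _ = int volume fun u : Fin m → ℝ => int volume fun v : Fin m → ℝ => C * b *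
            (w t u v * phi m σ' v * (of (pwp (gate a u) (g + s - 1)) * (w s u y * wall a y)
              * psi a g m κ' y)) := int_swap (by fun_prop)
      _ = _ := by
          refine int_congr fun u => ?_
          have h := int_w_phi (-t) σ' u
          rw [neg_neg] at h
          simp only [sub_neg_eq_add] at h
          rw [int_const_mul _ _ (by fun_prop), int_mul_const _ _ (by fun_prop), h]
          simp only [mul_assoc]
  -- The Gamma product is used as an eigenvalue backwards: it restores a GL Baxter kernel with
  -- parameter -s, which completes the BC Baxter kernel acting on `psi`.
  have h3 : (∏ j : Fin m, gam (σ' j + s)) * (int volume fun y : Fin m → ℝ =>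
        int volume fun u : Fin m → ℝ =>
        phi m σ' u * (of (pwp (gate a u) (g + s - 1)) * (w s u y * wall a y) * psi a g m κ' y))
      = (∏ k, gam (s - κ' k) * gam (s + κ' k)) * int volume fun x : Fin m → ℝ =>
          phi m σ' x * psi a g m κ' x := by
    calc _ = int volume fun y : Fin m → ℝ => int volume fun u : Fin m → ℝ =>
            int volume fun x : Fin m → ℝ => w s u x * phi m σ' x *
            (of (pwp (gate a u) (g + s - 1)) * (w s u y * wall a y) * psi a g m κ' y) := by
          rw [← int_const_mul₂ _ (by fun_prop)]
          refine int_congr fun y => int_congr fun u => ?_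
          have h := int_w_phi (-s) σ' u
          rw [neg_neg] at h
          simp only [sub_neg_eq_add] at h
          rw [int_mul_const _ _ (by fun_prop), h]
          simp only [mul_assoc]
      _ = int volume fun x : Fin m → ℝ => int volume fun y : Fin m → ℝ =>
            int volume fun u : Fin m → ℝ => w s u x * phi m σ' x *
            (of (pwp (gate a u) (g + s - 1)) * (w s u y * wall a y) * psi a g m κ' y) :=
          (int_rotate (by fun_prop)).symm
      _ = int volume fun x : Fin m → ℝ => phi m σ' x * int volume fun y : Fin m → ℝ =>
            baxter a g s x y * psi a g m κ' y := by
          refine int_congr fun x => ?_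
          rw [← int_const_mul _ _ (by fun_prop)]
          refine int_congr fun y => ?_
          rw [baxter, ← int_mul_const _ _ (by fun_prop), ← int_const_mul _ _ (by fun_prop)]
          refine int_congr fun u => ?_
          ac_rfl
      _ = _ := by
          rw [← int_const_mul _ _ (by fun_prop)]
          refine int_congr fun x => ?_
          rw [int_baxter_psi ha, mul_left_comm]
  rw [h1, h2]
  calc _ = (∏ j, gam (σ j - t)) * (∏ j, gam (σ' j + t)) * C * b *
        ((∏ j : Fin m, gam (σ' j + s)) * (int volume fun y : Fin m → ℝ =>
        int volume fun u : Fin m → ℝ =>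
        phi m σ' u * (of (pwp (gate a u) (g + s - 1)) * (w s u y * wall a y)
          * psi a g m κ' y))) := by ac_rfl
    _ = _ := by rw [h3]; simp only [mul_assoc]; rfl

end reflection

end Toda

end

/-! ### Closed form and convergence of the scalar product. -/

noncomputable section

namespace Toda

open scoped ENNReal
open DomC Finset

section scalarProduct

theorem prod_prod_Ioi_succ {M : Type*} [CommMonoid M] {m : ℕ} (f : Fin (m + 1) → Fin (m + 1) → M) :
    ∏ j, ∏ k ∈ Ioi j, f j k
      = (∏ j : Fin m, ∏ k ∈ Ioi j, f j.castSucc k.castSucc)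
        * ∏ j : Fin m, f j.castSucc (Fin.last m) := by
  have h : ∀ (n : ℕ) (F : Fin n → Fin n → M) (j : Fin n),
      ∏ k ∈ Ioi j, F j k = ∏ k, if j < k then F j k else 1 := fun n F j => by
    rw [← prod_filter]
    congr 1
    ext k
    simp
  simp only [h _ f, h _ fun j k : Fin m => f j.castSucc k.castSucc]
  rw [Fin.prod_univ_castSucc, ← prod_mul_distrib]
  simp only [Fin.prod_univ_castSucc, Fin.castSucc_lt_castSucc_iff, Fin.castSucc_lt_last, if_true,
    (Fin.castSucc_lt_last _).not_gt, lt_irrefl, if_false, prod_const_one, mul_one]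

theorem bd_prod_ne_top {ι : Type*} (s : Finset ι) {f : ι → DomC} (h : ∀ i ∈ s, (f i).bd ≠ ∞) :
    (∏ i ∈ s, f i).bd ≠ ∞ := by
  rw [bd_prod]
  exact ENNReal.prod_ne_top h

theorem bd_mul_ne_top {d e : DomC} (hd : d.bd ≠ ∞) (he : e.bd ≠ ∞) : (d * e).bd ≠ ∞ :=
  ENNReal.mul_ne_top hd he

theorem bd_ex_ne_top (t : ℂ) : (ex t).bd ≠ ∞ := enorm_ne_top

/-- The scalar product of the wave functions of the two chains. -/
theorem int_phi_psi {a : ℝ} (ha : 0 < a) (g : ℂ) (n : ℕ) (σ κ : Fin n → ℂ)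
    (hσ : ∀ j, 0 < (σ j).re) (hκ : ∀ k, 0 < (g - κ k).re)
    (hm : ∀ j k, 0 < (σ j - κ k).re) (hp : ∀ j k, 0 < (σ j + κ k).re) :
    (int volume fun x : Fin n → ℝ => phi n σ x * psi a g n κ x).bd ≠ ∞ ∧
    (int volume fun x : Fin n → ℝ => phi n σ x * psi a g n κ x).val
      = Complex.exp (-(∑ j, σ j + ∑ k, κ k) * Real.log a)
        * (∏ j, ∏ k, (Complex.Gamma (σ j + κ k) * Complex.Gamma (σ j - κ k)))
        * (∏ k, Complex.Gamma (g - κ k))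
        / ((∏ j, ∏ k ∈ Ioi j, Complex.Gamma (σ j + σ k)) * ∏ j, Complex.Gamma (g + σ j)) := by
  induction n with
  | zero =>
    rw [int_unique (volume : Measure (Fin 0 → ℝ))]
    simp [phi, psi]
  | succ m ih =>
    obtain ⟨ih1, ih2⟩ := ih (fun j => σ j.castSucc) (fun j => κ j.castSucc) (fun j => hσ _)
      (fun k => hκ _) (fun j k => hm _ _) (fun j k => hp _ _)
    have h := int_phi_psi_succ ha g σ κ
    set l := Fin.last m with hl
    have hgσ : (σ l + κ l + (g - κ l)) = g + σ l := by ring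
    have hss : ∀ j : Fin m, 0 < (σ j.castSucc + σ l).re := fun j => by
      rw [Complex.add_re]; exact add_pos (hσ _) (hσ _)
    have hD : (∏ j : Fin m, gam (σ j.castSucc + σ l)).bd ≠ 0 := by
      rw [bd_prod]
      exact prod_ne_zero_iff.2 fun j _ => bd_gam_ne_zero (hss j)
    have hbd := congrArg DomC.bd h
    have hval := congrArg DomC.val h
    constructor
    -- An infinite bound, multiplied by a nonzero Gamma product, would equal a product of finite
    -- bounds.
    · intro ht
      rw [bd_mul, ht, ENNReal.mul_top hD] at hbd
      refine absurd hbd.symm (bd_mul_ne_top (bd_mul_ne_top (bd_mul_ne_top (bd_mul_ne_top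
        (bd_mul_ne_top ?_ ?_) (bd_ex_ne_top _)) ?_) ?_) ih1)
      · exact bd_prod_ne_top _ fun j _ => bd_gam_ne_top (hm _ _)
      · exact bd_prod_ne_top _ fun j _ => bd_gam_ne_top (hp _ _)
      · exact bd_bet_ne_top (hp _ _) (hκ _)
      · exact bd_prod_ne_top _ fun j _ =>
          bd_mul_ne_top (bd_gam_ne_top (hm _ _)) (bd_gam_ne_top (hp _ _))
    · simp only [DomC.val_mul, DomC.val_prod] at hval
      have e1 : ∀ j, (gam (σ j - κ l)).val = Complex.Gamma (σ j - κ l) := fun j => val_gam (hm _ _)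
      have e2 : ∀ j : Fin m, (gam (σ j.castSucc + κ l)).val = Complex.Gamma (σ j.castSucc + κ l) :=
        fun j => val_gam (hp _ _)
      have e3 : ∀ j : Fin m, (gam (σ j.castSucc + σ l)).val = Complex.Gamma (σ j.castSucc + σ l) :=
        fun j => val_gam (hss j)
      have e4 : ∀ k : Fin m, (gam (σ l - κ k.castSucc)).val = Complex.Gamma (σ l - κ k.castSucc) :=
        fun k => val_gam (hm _ _)
      have e5 : ∀ k : Fin m, (gam (σ l + κ k.castSucc)).val = Complex.Gamma (σ l + κ k.castSucc) :=
        fun k => val_gam (hp _ _)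
      simp only [e1, e2, e3, e4, e5, val_bet (hp l l) (hκ l), hgσ, ih2, ex, DomC.val_of] at hval
      have hΓ : ∀ j, Complex.Gamma (g + σ j) ≠ 0 := fun j =>
        Complex.Gamma_ne_zero_of_re_pos (by
          rw [show g + σ j = (g - κ l) + (σ j + κ l) by ring, Complex.add_re]
          exact add_pos (hκ l) (hp j l))
      have hΓ2 : ∀ j k, Complex.Gamma (σ j + σ k) ≠ 0 := fun j k =>
        Complex.Gamma_ne_zero_of_re_pos (by rw [Complex.add_re]; exact add_pos (hσ _) (hσ _))
      have n1 : (∏ j : Fin m, Complex.Gamma (σ j.castSucc + σ l)) ≠ 0 :=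
        prod_ne_zero_iff.2 fun j _ => hΓ2 _ _
      have n2 : (∏ j : Fin m, ∏ k ∈ Ioi j, Complex.Gamma (σ j.castSucc + σ k.castSucc)) ≠ 0 :=
        prod_ne_zero_iff.2 fun j _ => prod_ne_zero_iff.2 fun k _ => hΓ2 _ _
      have n3 : (∏ j : Fin m, Complex.Gamma (g + σ j.castSucc)) ≠ 0 :=
        prod_ne_zero_iff.2 fun j _ => hΓ _
      have n4 := hΓ l
      apply mul_left_cancel₀ n1
      rw [hval, prod_prod_Ioi_succ fun j k => Complex.Gamma (σ j + σ k)]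
      simp only [Fin.sum_univ_castSucc, Fin.prod_univ_castSucc, prod_mul_distrib, ← hl]
      rw [show -(∑ i : Fin m, σ i.castSucc + σ l + (∑ i : Fin m, κ i.castSucc + κ l))
          * (Real.log a : ℂ) = -(σ l + κ l) * Real.log a
          + -(∑ i : Fin m, σ i.castSucc + ∑ i : Fin m, κ i.castSucc) * Real.log a by ring,
        Complex.exp_add]
      generalize (∏ j : Fin m, Complex.Gamma (σ j.castSucc + σ l)) = N1 at *
      generalize (∏ j : Fin m, ∏ k ∈ Ioi j, Complex.Gamma (σ j.castSucc + σ k.castSucc)) = N2 at *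
      generalize (∏ j : Fin m, Complex.Gamma (g + σ j.castSucc)) = N3 at *
      generalize Complex.Gamma (g + σ l) = N4 at *
      rw [mul_div_assoc', mul_div_assoc', mul_div_assoc', div_mul_eq_mul_div, div_mul_eq_mul_div,
        div_div, div_eq_div_iff (by positivity) (by positivity)]
      ring

end scalarProduct

/-! ### Identification with the wave functions of the statement. -/

section wave

variable {m : ℕ}

theorem ep_castSucc (x : Fin (m + 1) → ℝ) (j : Fin m) : ep x j = Real.exp (x j.castSucc) :=
  ep_fin x j.castSucc

theorem em_succ (x : Fin (m + 1) → ℝ) (j : Fin m) : em x (j + 1) = Real.exp (-x j.succ) :=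
  em_fin x j.succ

theorem wexp_eq_sum (x : Fin (m + 1) → ℝ) (y : Fin m → ℝ) :
    wexp x y = ∑ j : Fin m, (Real.exp (x j.castSucc - y j) + Real.exp (y j - x j.succ)) := by
  rw [wexp_lower x y (by omega)]
  refine sum_congr rfl fun j _ => ?_
  rw [ep_castSucc, em_succ, sub_eq_add_neg, sub_eq_add_neg, Real.exp_add, Real.exp_add]
  ring

theorem wexp_eq_sum' (z x : Fin (m + 1) → ℝ) :
    wexp z x = ∑ j : Fin m, (Real.exp (z j.castSucc - x j.castSucc)
      + Real.exp (x j.castSucc - z j.succ)) + Real.exp (z (Fin.last m) - x (Fin.last m)) := by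
  rw [wexp_lower z x le_rfl, Fin.sum_univ_castSucc]
  congr 1
  · refine sum_congr rfl fun j _ => ?_
    rw [sub_eq_add_neg, sub_eq_add_neg, Real.exp_add, Real.exp_add, ← em_succ z j, ← ep_castSucc z j]
    simp only [Fin.val_castSucc]
    ring
  · have h : ep z m = Real.exp (z (Fin.last m)) := ep_fin z (Fin.last m)
    rw [Fin.val_last, em_of_le z le_rfl, h, sub_eq_add_neg, Real.exp_add]
    ring

theorem w_eq_glKernel (lam : ℂ) (x : Fin (m + 1) → ℝ) (y : Fin m → ℝ) :
    w (Complex.I * lam) x y = of (glKernel lam x y) := by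
  rw [w, glKernel, ex, wexp_eq_sum]

theorem represents_phi (n : ℕ) (ρ : Fin n → ℂ) (x : Fin n → ℝ) :
    (phi n (fun j => Complex.I * ρ j) x).Represents (glWave n (fun j => -ρ j) x) := by
  induction n with
  | zero => exact fun _ => rfl
  | succ m ih =>
    refine Represents.int (by fun_prop) fun y => ?_
    rw [← mul_neg, w_eq_glKernel]
    exact (represents_of _).mul (ih _ _)

/-- The Bochner integral of such a product factors without any integrability assumption, so the BC
kernel can be rewritten at every point. -/
theorem integral_eval_zero_mul (h : ℝ → ℂ) (r : (Fin m → ℝ) → ℂ) :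
    ∫ z : Fin (m + 1) → ℝ, h (z 0) * r (fun j => z j.succ) = (∫ t, h t) * ∫ y, r y := by
  have hp := (volume_preserving_piFinSuccAbove (fun _ : Fin (m + 1) => ℝ) 0).symm
  rw [← hp.integral_comp', ← integral_prod_mul]
  rfl

/-- The change of variables at the wall. -/
theorem integral_bcBoundary {β : ℝ} (hβ : 0 < β) (g : ℝ) (lam : ℂ) (B : ℝ) :
    ∫ t : ℝ, bcBoundary β g lam t * Complex.exp (-2 * (Complex.I * lam) * t
        - (B * Real.exp t : ℝ)) * Complex.exp (-(β * B : ℝ))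
      = ∫ t : ℝ, pwp (1 - 2 * β * Real.exp (-t)) (g - Complex.I * lam - 1)
        * Complex.exp (-2 * (Complex.I * lam) * t - (B * Real.exp t : ℝ)) := by
  set κ := Complex.I * lam
  -- In the new coordinate (e^t - β)/(e^t + β) becomes 1 - 2β e^{-s}, and the shift of e^t absorbs
  -- the factor exp(-βB).
  set f : ℝ → ℝ := fun t => Real.log (Real.exp t + β) with hf
  have hpos : ∀ t, 0 < Real.exp t + β := fun t => by positivity
  have hfe : ∀ t, Real.exp (f t) = Real.exp t + β := fun t => Real.exp_log (hpos t)
  have hinj : Set.InjOn f (Set.Ioi (Real.log β)) := fun x _ y _ h => by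
    have h1 := hfe x
    rw [h, hfe y] at h1
    exact Real.exp_injective (by linarith)
  have hder : ∀ t ∈ Set.Ioi (Real.log β), HasDerivWithinAt f
      (Real.exp t / (Real.exp t + β)) (Set.Ioi (Real.log β)) t := fun t _ =>
    (((Real.hasDerivAt_exp t).add_const β).log (hpos t).ne').hasDerivWithinAt
  have himg : f '' Set.Ioi (Real.log β) = Set.Ioi (Real.log (2 * β)) := by
    ext s
    constructor
    · rintro ⟨t, ht, rfl⟩
      have : β < Real.exp t := (Real.log_lt_iff_lt_exp hβ).1 ht
      exact Real.log_lt_log (by positivity) (by linarith)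
    · intro hs
      have h1 : 2 * β < Real.exp s := (Real.log_lt_iff_lt_exp (by positivity)).1 hs
      refine ⟨Real.log (Real.exp s - β), Real.log_lt_log hβ (by linarith), ?_⟩
      rw [hf]
      simp only
      rw [Real.exp_log (by linarith), sub_add_cancel, Real.log_exp]
  have hl : ∫ t : ℝ, bcBoundary β g lam t * Complex.exp (-2 * κ * t - (B * Real.exp t : ℝ))
        * Complex.exp (-(β * B : ℝ))
      = ∫ t in Set.Ioi (Real.log β), bcBoundary β g lam t
        * Complex.exp (-2 * κ * t - (B * Real.exp t : ℝ)) * Complex.exp (-(β * B : ℝ)) := by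
    -- The step function equals 1 at t = log β as well; this endpoint is a null set.
    rw [← integral_Ici_eq_integral_Ioi]
    refine (setIntegral_eq_integral_of_forall_compl_eq_zero fun t ht => ?_).symm
    have : heaviside (t - Real.log β) = 0 := if_neg (by rw [sub_nonneg]; exact ht)
    rw [bcBoundary, this]
    simp
  have hr : ∫ t : ℝ, pwp (1 - 2 * β * Real.exp (-t)) (g - κ - 1)
        * Complex.exp (-2 * κ * t - (B * Real.exp t : ℝ))
      = ∫ t in Set.Ioi (Real.log (2 * β)), pwp (1 - 2 * β * Real.exp (-t)) (g - κ - 1)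
        * Complex.exp (-2 * κ * t - (B * Real.exp t : ℝ)) := by
    refine (setIntegral_eq_integral_of_forall_compl_eq_zero fun t ht => ?_).symm
    have h1 : t ≤ Real.log (2 * β) := not_lt.1 ht
    have h2 : Real.exp t ≤ 2 * β := (Real.le_log_iff_exp_le (by positivity)).1 h1
    rw [pwp_of_nonpos, zero_mul]
    rw [sub_nonpos, Real.exp_neg, ← div_eq_mul_inv, le_div_iff₀ (Real.exp_pos t), one_mul]
    exact h2
  rw [hl, hr, ← himg, integral_image_eq_integral_abs_deriv_smul measurableSet_Ioi hder hinj]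
  refine setIntegral_congr_fun measurableSet_Ioi fun t ht => ?_
  have h1 : β < Real.exp t := (Real.log_lt_iff_lt_exp hβ).1 ht
  have h2 : 0 < 1 + β * Real.exp (-t) := by positivity
  have h3 : 1 + β * Real.exp (-t) = (Real.exp t + β) / Real.exp t := by
    rw [Real.exp_neg]; field_simp
  have h4 : 1 - β * Real.exp (-t) = (Real.exp t - β) / Real.exp t := by
    rw [Real.exp_neg]; field_simp
  have h5 : 1 - 2 * β * Real.exp (-f t) = (Real.exp t - β) / (Real.exp t + β) := by
    rw [Real.exp_neg, hfe]
    field_simp [(hpos t).ne']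
    ring
  have h6 : 0 < Real.exp t - β := by linarith
  have h7 : heaviside (t - Real.log β) = 1 := if_pos (by linarith [Set.mem_Ioi.1 ht])
  have h8 : Real.exp t / (Real.exp t + β) = Real.exp (t - f t) := by
    rw [Real.exp_sub, hfe]
  rw [bcBoundary, h3, h4, h5, h7, ← pwp_eq_cpow (div_pos (hpos t) (Real.exp_pos t)),
    ← pwp_eq_cpow (div_pos h6 (Real.exp_pos t)), pwp_of_pos (div_pos (hpos t) (Real.exp_pos t)),
    pwp_of_pos (div_pos h6 (Real.exp_pos t)), pwp_of_pos (div_pos h6 (hpos t)),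
    Real.log_div (hpos t).ne' (Real.exp_pos t).ne', Real.log_div h6.ne' (Real.exp_pos t).ne',
    Real.log_div h6.ne' (hpos t).ne', Real.log_exp, h8, abs_of_pos (Real.exp_pos _), hfe,
    Complex.real_smul, Complex.ofReal_exp, Complex.ofReal_one, mul_one]
  simp only [← Complex.exp_add]
  congr 1
  rw [hf]
  push_cast
  ring

theorem val_w {m n : ℕ} (τ : ℂ) (z : Fin n → ℝ) (y : Fin m → ℝ) : (w τ z y).val
    = Complex.exp (τ * ((∑ j, z j - ∑ j, y j : ℝ) : ℂ) - (wexp z y : ℝ)) := rfl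

/-- The normalization of the kernel of the `BC` raising operator. -/
def raiseConst (β g : ℝ) (lam : ℂ) : ℂ :=
  ((2 * β : ℝ) : ℂ) ^ (Complex.I * lam) / Complex.Gamma ((g : ℂ) - Complex.I * lam)

/-- Only the coordinate z_0 is affected, by the change of variables at the wall. The resulting
exponential conjugates the kernel by exp(-β e^{-x_0}) and leaves the wall factor exp(2β e^{-y_0}).
-/
theorem bcKernel_eq {β : ℝ} (hβ : 0 < β) (g : ℝ) (lam : ℂ) (x : Fin (m + 1) → ℝ)
    (y : Fin m → ℝ) :
    bcKernel β g lam x y * Complex.exp (-(β * em x 0 : ℝ))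
      = raiseConst β g lam * (∫ z : Fin (m + 1) → ℝ, (w (-(Complex.I * lam)) z x).val
          * pwp (gate (2 * β) z) (g - Complex.I * lam - 1)
          * ((w (-(Complex.I * lam)) z y).val * (wall (2 * β) y).val))
        * Complex.exp (-(β * em y 0 : ℝ)) := by
  set κ := Complex.I * lam with hκ
  set B := em x 0 + em y 0 with hB
  set r : (Fin m → ℝ) → ℂ := fun v => Complex.exp (κ * ((∑ j, x j + ∑ j, y j - 2 * ∑ j, v j : ℝ) : ℂ)
    - (∑ j : Fin m, (ep x j * Real.exp (-v j) + em x (j + 1) * Real.exp (v j)) +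
      ∑ j : Fin m, (ep y j * Real.exp (-v j) + em y (j + 1) * Real.exp (v j)) : ℝ)) with hr
  have h1 : ∀ z : Fin (m + 1) → ℝ, bcBoundary β g lam (z 0)
          * Complex.exp
            (Complex.I * lam * (((∑ j, x j) + (∑ j, y j) - 2 * ∑ j, z j : ℝ) : ℂ)
              - ((∑ j : Fin m,
                    (Real.exp (z j.castSucc - x j.castSucc) + Real.exp (z j.castSucc - y j)
                      + Real.exp (x j.castSucc - z j.succ) + Real.exp (y j - z j.succ)) : ℝ) : ℂ)
              - ((Real.exp (z (Fin.last m) - x (Fin.last m)) : ℝ) : ℂ))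
      = bcBoundary β g lam (z 0) * Complex.exp (-2 * κ * z 0 - (B * Real.exp (z 0) : ℝ))
        * r fun j => z j.succ := by
    intro z
    have e1 : ∑ j : Fin m,
          (Real.exp (z j.castSucc - x j.castSucc) + Real.exp (z j.castSucc - y j)
            + Real.exp (x j.castSucc - z j.succ) + Real.exp (y j - z j.succ))
          + Real.exp (z (Fin.last m) - x (Fin.last m)) = wexp z x + wexp z y := by
      rw [wexp_eq_sum', wexp_eq_sum, add_right_comm, ← sum_add_distrib]
      congr 1
      refine sum_congr rfl fun j _ => ?_
      ring
    rw [sub_sub, ← Complex.ofReal_add, e1, wexp_upper, wexp_upper, hr,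
      mul_assoc (bcBoundary β g lam (z 0)), ← Complex.exp_add, Fin.sum_univ_succ z]
    congr 2
    rw [hB]
    push_cast
    ring
  have h2 : ∀ z : Fin (m + 1) → ℝ, (w (-κ) z x).val
          * pwp (gate (2 * β) z) (g - κ - 1) * ((w (-κ) z y).val * (wall (2 * β) y).val)
      = (wall (2 * β) y).val * (pwp (1 - 2 * β * Real.exp (-z 0)) (g - κ - 1)
        * Complex.exp (-2 * κ * z 0 - (B * Real.exp (z 0) : ℝ)) * r fun j => z j.succ) := by
    intro z
    have hg : gate (2 * β) z = 1 - 2 * β * Real.exp (-z 0) := by rw [gate, ← em_fin z 0]; rfl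
    have e2 : (w (-κ) z x).val * (w (-κ) z y).val
        = Complex.exp (-2 * κ * z 0 - (B * Real.exp (z 0) : ℝ)) * r fun j => z j.succ := by
      rw [val_w, val_w, hr, ← Complex.exp_add, ← Complex.exp_add, wexp_upper, wexp_upper,
        Fin.sum_univ_succ z, hB]
      congr 1
      push_cast
      ring
    rw [hg, mul_assoc (pwp _ _), ← e2]
    ring
  have hwall : (wall (2 * β) y).val = Complex.exp ((2 * β * em y 0 : ℝ)) := rfl
  rw [bcKernel, integral_congr_ae (.of_forall h1), integral_congr_ae (.of_forall h2),
    integral_const_mul,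
    integral_eval_zero_mul (fun t => bcBoundary β g lam t *
      Complex.exp (-2 * κ * t - (B * Real.exp t : ℝ))) r,
    integral_eval_zero_mul (fun t => pwp (1 - 2 * β * Real.exp (-t)) (g - κ - 1) *
      Complex.exp (-2 * κ * t - (B * Real.exp t : ℝ))) r,
    ← integral_bcBoundary hβ g lam B, integral_mul_const, hwall, raiseConst]
  -- With B the sum of the boundary exponentials of x and y, the exponents balance as -X = 2Y - (X +
  -- Y) - Y.
  have e3 : Complex.exp (-(β * em x 0 : ℝ)) = Complex.exp ((2 * β * em y 0 : ℝ))
      * Complex.exp (-(β * B : ℝ)) * Complex.exp (-(β * em y 0 : ℝ)) := by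
    rw [← Complex.exp_add, ← Complex.exp_add, hB]
    congr 1
    push_cast
    ring
  rw [e3]
  ring

theorem represents_raiseKer (a g : ℝ) (κ : ℂ) (x : Fin (m + 1) → ℝ) (y : Fin m → ℝ) :
    (raiseKer a g κ x y).Represents (∫ z : Fin (m + 1) → ℝ, (w (-κ) z x).val
      * pwp (gate a z) (g - κ - 1) * ((w (-κ) z y).val * (wall a y).val)) :=
  Represents.int (by fun_prop) fun _ _ => rfl

/-- The gauge factor at x is passed by `bcKernel_eq` to y, where the induction hypothesis contains
it, so it propagates through the recursion. -/
theorem represents_psi {β : ℝ} (hβ : 0 < β) (g : ℝ) (n : ℕ) (lam : Fin n → ℂ)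
    (hg : ∀ k, 0 < ((g : ℂ) - Complex.I * lam k).re) (x : Fin n → ℝ) :
    (psi (2 * β) g n (fun k => Complex.I * lam k) x).Represents
      (bcWave β g n lam x * Complex.exp (-(β * em x 0 : ℝ)) / ∏ k, raiseConst β g (lam k)) := by
  induction n with
  | zero => intro _; simp [psi, bcWave, em]
  | succ m ih =>
    have hc : raiseConst β g (lam (Fin.last m)) ≠ 0 := by
      refine div_ne_zero ?_ (Complex.Gamma_ne_zero_of_re_pos (hg _))
      rw [Complex.cpow_ne_zero_iff]
      left
      exact_mod_cast (by positivity : (2 * β) ≠ 0)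
    have h := Represents.int (μ := volume) (F := fun y => raiseKer (2 * β) g
        (Complex.I * lam (Fin.last m)) x y * psi (2 * β) g m (fun k => Complex.I * lam k.castSucc) y)
      (by fun_prop) fun y => (represents_raiseKer (2 * β) g (Complex.I * lam (Fin.last m)) x y).mul
        (ih (fun k => lam k.castSucc) (fun k => hg _) y)
    convert h using 1
    · rfl
    have hW : bcWave β g (m + 1) lam x = ∫ y, bcKernel β g (lam (Fin.last m)) x y
        * bcWave β g m (fun j => lam j.castSucc) y := rfl
    rw [hW, Fin.prod_univ_castSucc, ← integral_mul_const, ← integral_div]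
    congr 1
    funext y
    have hk := bcKernel_eq hβ g (lam (Fin.last m)) x y
    generalize (∫ z : Fin (m + 1) → ℝ, (w (-(Complex.I * lam (Fin.last m))) z x).val
      * pwp (gate (2 * β) z) (g - Complex.I * lam (Fin.last m) - 1)
      * ((w (-(Complex.I * lam (Fin.last m))) z y).val * (wall (2 * β) y).val)) = J at hk ⊢
    rw [mul_right_comm, hk]
    field_simp

end wave

end Toda

end

/-! ### The integral formula. -/

theorem proposition2p5 (α β : ℝ) (hβ : 0 < β) (hg : 0 < Toda.coupling α β)
    (n : ℕ) (hn : 0 < n) (lam : Fin n → ℝ) (ρ : Fin n → ℂ)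
    (hρ_eq : ∀ j k, (ρ j).im = (ρ k).im) (hρ_neg : ∀ j, (ρ j).im < 0) :
    Integrable (fun x : Fin n → ℝ =>
        Toda.glWave n (fun j => -ρ j) x
          * Toda.bcWave β (Toda.coupling α β) n (fun j => (lam j : ℂ)) x
          * ((Real.exp (-β * Real.exp (-x ⟨0, hn⟩)) : ℝ) : ℂ)) ∧
    ∫ x : Fin n → ℝ,
        Toda.glWave n (fun j => -ρ j) x
          * Toda.bcWave β (Toda.coupling α β) n (fun j => (lam j : ℂ)) x
          * ((Real.exp (-β * Real.exp (-x ⟨0, hn⟩)) : ℝ) : ℂ)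
      = (((2 * β : ℝ) : ℂ) ^ (-(Complex.I * ∑ j, ρ j))
          * ∏ j, ∏ k, (Complex.Gamma (Complex.I * ρ j + Complex.I * (lam k : ℂ))
              * Complex.Gamma (Complex.I * ρ j - Complex.I * (lam k : ℂ))))
        / ((∏ j, ∏ k ∈ Finset.Ioi j, Complex.Gamma (Complex.I * ρ j + Complex.I * ρ k))
          * ∏ j, Complex.Gamma (((Toda.coupling α β : ℝ) : ℂ) + Complex.I * ρ j)) := by
  set g := Toda.coupling α β
  set σ : Fin n → ℂ := fun j => Complex.I * ρ j with hσ
  set κ : Fin n → ℂ := fun k => Complex.I * (lam k : ℂ) with hκ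
  have hσre : ∀ j, 0 < (σ j).re := fun j => by simpa [hσ] using hρ_neg j
  have hκre : ∀ k, (κ k).re = 0 := fun k => by simp [hκ]
  have hgκ : ∀ k, 0 < ((g : ℂ) - κ k).re := fun k => by
    rw [Complex.sub_re, hκre, sub_zero]; exact hg
  obtain ⟨h1, h2⟩ := Toda.int_phi_psi (a := 2 * β) (by positivity) g n σ κ hσre hgκ
    (fun j k => by rw [Complex.sub_re, hκre, sub_zero]; exact hσre j)
    (fun j k => by rw [Complex.add_re, hκre, add_zero]; exact hσre j)
  set c := ∏ k, Toda.raiseConst β g (lam k) with hc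
  have hb : ((2 * β : ℝ) : ℂ) ≠ 0 := by exact_mod_cast (by positivity : (2 * β) ≠ 0)
  have hc0 : c ≠ 0 := Finset.prod_ne_zero_iff.2 fun k _ =>
    div_ne_zero (by rw [Complex.cpow_ne_zero_iff]; exact Or.inl hb)
      (Complex.Gamma_ne_zero_of_re_pos (hgκ k))
  have hm : Measurable fun x : Fin n → ℝ => Toda.phi n σ x * Toda.psi (2 * β) g n κ x := by fun_prop
  have hrep : ∀ x : Fin n → ℝ, (Toda.phi n σ x * Toda.psi (2 * β) g n κ x).Represents
      (Toda.glWave n (fun j => -ρ j) x * (Toda.bcWave β g n (fun j => (lam j : ℂ)) x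
        * Complex.exp (-(β * Toda.em x 0 : ℝ)) / c)) := fun x =>
    (Toda.represents_phi n ρ x).mul (Toda.represents_psi hβ g n _ hgκ x)
  have hae := Toda.DomC.ae_val_eq hm hrep h1
  have hint := Toda.DomC.integrable_val hm h1
  -- The two sides need agree only almost everywhere, where the bound of the dominated integrand is
  -- finite; c restores the normalization removed from `psi`.
  have hF : ∀ᵐ x : Fin n → ℝ, c * (Toda.phi n σ x * Toda.psi (2 * β) g n κ x).val
      = Toda.glWave n (fun j => -ρ j) x * Toda.bcWave β g n (fun j => (lam j : ℂ)) x
          * ((Real.exp (-β * Real.exp (-x ⟨0, hn⟩)) : ℝ) : ℂ) := by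
    filter_upwards [hae] with x hx
    rw [hx, Complex.ofReal_exp, Toda.em, dif_pos hn, ← Complex.ofReal_neg, ← neg_mul]
    field_simp
  refine ⟨(hint.const_mul c).congr hF, ?_⟩
  rw [← integral_congr_ae hF, integral_const_mul, ← Toda.DomC.val_int h1, h2, hc]
  -- The normalization cancels ∏Γ(g - κ_k) and the part of the power of 2β that depends on λ.
  have hcv : ∏ k, Toda.raiseConst β g (lam k)
      = Complex.exp ((∑ k, κ k) * Real.log (2 * β)) / ∏ k, Complex.Gamma (g - κ k) := by
    simp only [Toda.raiseConst]
    rw [Finset.prod_div_distrib, Finset.sum_mul, Complex.exp_sum]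
    congr 1
    refine Finset.prod_congr rfl fun k _ => ?_
    rw [← Toda.pwp_eq_cpow (by positivity), Toda.pwp_of_pos (by positivity)]
  have hΓ : ∏ k, Complex.Gamma (g - κ k) ≠ 0 :=
    Finset.prod_ne_zero_iff.2 fun k _ => Complex.Gamma_ne_zero_of_re_pos (hgκ k)
  have hexp : ((2 * β : ℝ) : ℂ) ^ (-(Complex.I * ∑ j, ρ j))
      = Complex.exp ((∑ k, κ k) * Real.log (2 * β))
        * Complex.exp (-(∑ j, σ j + ∑ k, κ k) * Real.log (2 * β)) := by
    rw [← Toda.pwp_eq_cpow (by positivity), Toda.pwp_of_pos (by positivity), ← Complex.exp_add,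
      hσ, Finset.mul_sum]
    congr 1
    ring
  change _ = _ * (∏ j, ∏ k, (Complex.Gamma (σ j + κ k) * Complex.Gamma (σ j - κ k)))
    / ((∏ j, ∏ k ∈ Finset.Ioi j, Complex.Gamma (σ j + σ k)) * ∏ j, Complex.Gamma (g + σ j))
  rw [hcv, hexp]
  field_simp
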